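/- Let $\{\pm1\}\subset\Gamma\subset\operatorname{SL}(2,\mathbb R)$ be a discrete subgroup such that $\Gamma\backslash\mathbb H$ is non-compact with finite hyperbolic area $\operatorname{vol}_{\mathbb H}(\mathcal F_\Gamma)$, where $\mathcal F_\Gamma\subset\mathbb H$ is a fundamental domain. Put $$n(s)=\begin{pmatrix}1&s\\0&1\end{pmatrix},\qquad a(t)=\begin{pmatrix}e^{t/2}&0\\0&e^{-t/2}\end{pmatrix},$$ and on $\mathcal X=\Gamma\backslash\operatorname{SL}(2,\mathbb R)$ let $\varphi_t(x)=x\,a(t)$, $h^-_s(x)=x\,n(s)$ and $h^+_s(x)=x\begin{pmatrix}1&0\\-s&1\end{pmatrix}$. Let $1,\dots,K$ ($K\ge1$) label a complete set of pairwise inequivalent cusps of $\Gamma$, and for each $\kappa$ let $g_\kappa\in\operatorname{SL}(2,\mathbb R)$ map the cusp $\kappa$ to a cusp at $\infty$ of width one; that is, the cusp is $g_\kappa^{-1}\infty$ and its stabiliser in $\Gamma$ is $\{\pm g_\kappa^{-1}n(m)g_\kappa:m\in\mathbb Z\}$. Put $x_\kappa=\Gamma g_\kappa^{-1}$, $\mathcal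 C_\kappa=\{h^-_s(x_\kappa):s\in\mathbb R\}$ and $\mathcal H_\kappa(R)=\{\varphi_t(x): x\in\mathcal C_\kappa,\ t\ge R\}$. For $\sigma=(\sigma_1,\dots,\sigma_K)\in\mathbb R^K$ let $\mathcal H(\sigma)=\bigcup_\kappa\mathcal H_\kappa(\sigma_\kappa)$ and $\Sigma^K(\sigma)=\{(s,t,\kappa): s\in[0,1),\ t\ge\sigma_\kappa,\ \kappa\in\{1,\dots,K\}\}$. For $(s,t,\kappa)\in\Sigma^K(\sigma)$ let $\eta_{1}(s,t,\kappa,\sigma)$ and $\eta_{-1}(s,t,\kappa,\sigma)\in(0,\infty]$ be the infimum of all $r>0$ such that $h^+_{r}(x)\in\mathcal H(\sigma)$, respectively $h^+_{-r}(x)\in\mathcal H(\sigma)$, where $x=\varphi_t(h^-_s(x_\kappa))$ (the first return time and the first backwards return time). Let $\overline\eta_1(\sigma)$ be the mean return time, i.e. the average of $\eta_1$ with respect to the normalised measure $e^{-t}\,dt\,ds$ on the section: $$\overline\eta_1(\sigma)=\frac{\sum_{\kappa=1}^K\int_0^1\int_{\sigma_\kappa}^\infty\eta_1(s,t,\kappa,\sigma)\,e^{-t}\,dt\,ds}{\sum_{\kappa=1}^K\int_0^1\int_{\sigma_\kappa}^\infty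 e^{-t}\,dt\,ds},$$ and for $r>0$ put $$\Psi_\sigma(r,s,t,\kappa)=\frac1{\overline\eta_1(\sigma)}\,\mathbf 1\big(r<\eta_{-1}(s,t,\kappa,\sigma)\big).$$ Let $\mathcal P^\ell_\Gamma=\{(0,1)g_\ell\gamma:\gamma\in\Gamma\}\subset\mathbb R^2$ (row vectors) and $\Delta_{-r}=\{u\in\mathbb R^2: -r u_2\le u_1<0,\ 0<u_2\le1\}$. Then for all $\sigma\in\mathbb R^K$, $r>0$ and $(s,t,\kappa)\in\Sigma^K(\sigma)$, $$\Psi_\sigma(r,s,t,\kappa)=\frac1{\overline\eta_1(\sigma)}\prod_{\ell=1}^K\mathbf 1\Big(e^{\sigma_\ell/2}\,\mathcal P^\ell_\Gamma\,g_\kappa^{-1}\,n(s)\,a(t)\cap\Delta_{-r}=\emptyset\Big),$$ and $$\overline\eta_1(\sigma)=\pi\operatorname{vol}_{\mathbb H}(\mathcal F_\Gamma)\Big(\sum_{\kappa=1}^Ke^{-\sigma_\kappa}\Big)^{-1};$$ in particular, $\overline\eta_1(\sigma)$ is finite. -/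

import Mathlib

open scoped MatrixGroups UpperHalfPlane ENNReal

noncomputable section

namespace CuspSection

/-- `n(s)`, the upper unipotent matrix with entry `s`. -/
def upperUni (s : ℝ) : SL(2, ℝ) := ⟨!![1, s; 0, 1], by simp [Matrix.det_fin_two]⟩

/-- `a(t) = diag(e^{t/2}, e^{-t/2})`. -/
def diagExp (t : ℝ) : SL(2, ℝ) :=
  ⟨!![Real.exp (t / 2), 0; 0, Real.exp (-t / 2)], by
    rw [Matrix.det_fin_two_of, mul_zero, sub_zero, ← Real.exp_add, neg_div, add_neg_cancel,
      Real.exp_zero]⟩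

/-- The lower unipotent matrix with entry `r`. -/
def lowerUni (r : ℝ) : SL(2, ℝ) := ⟨!![1, 0; r, 1], by simp [Matrix.det_fin_two]⟩

/-- The unit tangent bundle `Γ \ SL(2,ℝ)` of the surface `Γ \ ℍ`: the space of cosets `Γ g`. -/
abbrev TangentBundle (Γ : Subgroup SL(2, ℝ)) : Type := Quotient (QuotientGroup.rightRel Γ)

/-- The point `Γ g`. -/
def pt (Γ : Subgroup SL(2, ℝ)) (g : SL(2, ℝ)) : TangentBundle Γ :=
  Quotient.mk (QuotientGroup.rightRel Γ) g

/-- Right multiplication `Γ g ↦ Γ g h`. -/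
def rightMul (Γ : Subgroup SL(2, ℝ)) (h : SL(2, ℝ)) : TangentBundle Γ → TangentBundle Γ :=
  Quotient.map (fun g => g * h) fun a b hab => by
    have hab' : b * a⁻¹ ∈ Γ := QuotientGroup.rightRel_apply.1 hab
    refine QuotientGroup.rightRel_apply.2 ?_
    simpa [mul_assoc] using hab'

/-- The geodesic flow `φ_t`. -/
def geodesicFlow (Γ : Subgroup SL(2, ℝ)) (t : ℝ) : TangentBundle Γ → TangentBundle Γ :=
  rightMul Γ (diagExp t)

/-- The stable horocycle flow `h⁻_s`. -/
def stableFlow (Γ : Subgroup SL(2, ℝ)) (s : ℝ) : TangentBundle Γ → TangentBundle Γ :=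
  rightMul Γ (upperUni s)

/-- The unstable horocycle flow `h⁺_s`. -/
def unstableFlow (Γ : Subgroup SL(2, ℝ)) (s : ℝ) : TangentBundle Γ → TangentBundle Γ :=
  rightMul Γ (lowerUni (-s))

/-- The boundary point `g⁻¹ ∞`, which `g` maps to `∞`. -/
def boundaryPoint (g : SL(2, ℝ)) : OnePoint ℝ :=
  Matrix.SpecialLinearGroup.toGL g⁻¹ • OnePoint.infty

/-- The points `(g κ)⁻¹ ∞`, `κ = 1, …, K`, form a complete system of pairwise inequivalent cusps
of `Γ`, and each `g κ` maps its cusp to a cusp at `∞` of width one. (As `-1 ∈ Γ`, the stabiliser of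
the cusp is described up to sign.) -/
structure IsCuspSystem (Γ : Subgroup SL(2, ℝ)) {K : ℕ} (g : Fin K → SL(2, ℝ)) : Prop where
  width_one : ∀ (κ : Fin K) (γ : SL(2, ℝ)),
    (γ ∈ Γ ∧ Matrix.SpecialLinearGroup.toGL γ • boundaryPoint (g κ) = boundaryPoint (g κ)) ↔
      ∃ m : ℤ, γ = (g κ)⁻¹ * upperUni m * g κ ∨ γ = -((g κ)⁻¹ * upperUni m * g κ)
  complete : ∀ c : OnePoint ℝ, IsCusp c (Γ.map Matrix.SpecialLinearGroup.toGL) →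
    ∃! κ : Fin K, ∃ γ ∈ Γ, Matrix.SpecialLinearGroup.toGL γ • c = boundaryPoint (g κ)

/-- `F` is a (measurable) fundamental domain in `ℍ` for the group of Möbius transformations given
by `Γ`; `volume` on `ℍ` is the hyperbolic area `dx dy / y²`. -/
def IsFundDomain (Γ : Subgroup SL(2, ℝ)) (F : Set ℍ) : Prop :=
  MeasureTheory.IsFundamentalDomain (Γ.map (MulAction.toPermHom SL(2, ℝ) ℍ)) F
    MeasureTheory.volume

variable (Γ : Subgroup SL(2, ℝ)) {K : ℕ} (g : Fin K → SL(2, ℝ)) (σ : Fin K → ℝ)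

/-- The closed stable horocycle `C_κ` of length one, through the base point `x_κ = Γ (g κ)⁻¹`. -/
def closedHorocycle (κ : Fin K) : Set (TangentBundle Γ) :=
  Set.range fun s : ℝ => stableFlow Γ s (pt Γ (g κ)⁻¹)

/-- The section `H_κ(R) = {φ_t(C_κ) : t ≥ R}`. -/
def cuspSection (κ : Fin K) (R : ℝ) : Set (TangentBundle Γ) :=
  ⋃ t ∈ Set.Ici R, geodesicFlow Γ t '' closedHorocycle Γ g κ

/-- The section `H(σ, R) = ⋃_κ H_κ(σ_κ + R)`. -/
def totalSection (R : ℝ) : Set (TangentBundle Γ) :=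
  ⋃ κ : Fin K, cuspSection Γ g κ (σ κ + R)

/-- The parametrisation `ι(s, t, κ) = φ_t (h⁻_s (x_κ))`. -/
def embed (s t : ℝ) (κ : Fin K) : TangentBundle Γ :=
  geodesicFlow Γ t (stableFlow Γ s (pt Γ (g κ)⁻¹))

/-- The first return time `η₁(s, t, κ, σ)` of `ι(s, t, κ)` to `H(σ, 0)` under the unstable horocycle
flow (`∞` if there is no return). -/
def returnTime (s t : ℝ) (κ : Fin K) : ℝ≥0∞ :=
  ⨅ (r : ℝ) (_ : 0 < r) (_ : unstableFlow Γ r (embed Γ g s t κ) ∈ totalSection Γ g σ 0),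
    ENNReal.ofReal r

/-- The first backwards return time `η₋₁(s, t, κ, σ)`. -/
def backReturnTime (s t : ℝ) (κ : Fin K) : ℝ≥0∞ :=
  ⨅ (r : ℝ) (_ : 0 < r) (_ : unstableFlow Γ (-r) (embed Γ g s t κ) ∈ totalSection Γ g σ 0),
    ENNReal.ofReal r

/-- Integration over `Σ^K(σ) = {(s, t, κ) : s ∈ [0,1), t ≥ σ_κ}` against the measure
`e^{-t} dt ds` on each of the `K` components. -/
def sectionIntegral (f : ℝ → ℝ → Fin K → ℝ≥0∞) : ℝ≥0∞ :=
  ∑ κ : Fin K, ∫⁻ s in Set.Ico (0 : ℝ) 1, ∫⁻ t in Set.Ici (σ κ),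
    f s t κ * ENNReal.ofReal (Real.exp (-t))

/-- The mean return time `η̄₁(σ)`: the average of `η₁` over the section, i.e. its integral against
the measure above, normalised to a probability measure. -/
def meanReturnTime : ℝ≥0∞ :=
  sectionIntegral σ (returnTime Γ g σ) / sectionIntegral σ (fun _ _ _ => 1)

open Classical in
/-- The density `Ψ_σ(r, s, t, κ) = η̄₁(σ)⁻¹ 1(r < η₋₁(s, t, κ, σ))`. -/
def density (r s t : ℝ) (κ : Fin K) : ℝ :=
  1 / (meanReturnTime Γ g σ).toReal *
    if ENNReal.ofReal r < backReturnTime Γ g σ s t κ then 1 else 0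

/-- The point set `P^ℓ_Γ = (0,1) g_ℓ Γ` of row vectors. -/
def cuspOrbit (ℓ : Fin K) : Set (Fin 2 → ℝ) :=
  {p | ∃ γ ∈ Γ, p = Matrix.vecMul ![0, 1] (g ℓ * γ).1}

/-- The triangle `Δ_{-X} = {u : -X u₂ ≤ u₁ < 0, 0 < u₂ ≤ 1}`. -/
def negTriangle (X : ℝ) : Set (Fin 2 → ℝ) :=
  {u | -X * u 1 ≤ u 0 ∧ u 0 < 0 ∧ 0 < u 1 ∧ u 1 ≤ 1}

/-- The scaled and deformed point set `c P h`. -/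
def scaledSet (c : ℝ) (P : Set (Fin 2 → ℝ)) (h : SL(2, ℝ)) : Set (Fin 2 → ℝ) :=
  (fun p => c • Matrix.vecMul p h.1) '' P

open Classical in
/-- The indicator function `1(S = ∅)`. -/
def emptyIndicator (S : Set (Fin 2 → ℝ)) : ℝ := if S = ∅ then 1 else 0

end CuspSection

end

/-!
Put `h⁺_r` for right multiplication by `lowerUni (-r)`. The point `Γ h h⁺_r` lies on the section
exactly when some vector of the scaled orbits `e^{σ_ℓ/2} P^ℓ_Γ h` has slope `u₁ / u₂ = r` and height
`0 < u₂ ≤ 1`. A backward return time larger than `r` therefore means that none of these vectors lies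
in the triangle `Δ_{-r}`, and this is the product formula.

For the mean return time, flow each point of the section up to just before its first return. In the
coordinates `n(s) a(t) h⁺_r` the Haar measure of `SL(2, ℝ)` is `e^{-t} ds dt dr`, so the flow boxes
obtained in this way have total mass `∑_κ ∫∫ η₁ e^{-t} dt ds`. They form a fundamental domain of
`Γ`: the last visit to the section determines a point of an orbit, and almost every orbit has
visited the section in the past. Indeed, right translation by `h⁺_n a(2 log (n + 1))` preserves the
Haar measure, while the preimages under it of the invariant set of points without a past visit
decrease to a null set; since `Γ` has finite covolume, that set is itself null. A fundamental domain
`F` in the upper half plane lifts to a second fundamental domain in `SL(2, ℝ)`, of mass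
`π vol(F)`, and any two fundamental domains have the same mass.
-/

noncomputable section

open MeasureTheory Set
open scoped Topology

namespace CuspSection

@[simp]
lemma upperUni_coe (s : ℝ) : (upperUni s : Matrix (Fin 2) (Fin 2) ℝ) = !![1, s; 0, 1] := rfl

@[simp]
lemma lowerUni_coe (s : ℝ) : (lowerUni s : Matrix (Fin 2) (Fin 2) ℝ) = !![1, 0; s, 1] := rfl

@[simp]
lemma diagExp_coe (t : ℝ) : (diagExp t : Matrix (Fin 2) (Fin 2) ℝ) =
    !![Real.exp (t / 2), 0; 0, Real.exp (-t / 2)] := rfl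

lemma mul_apply_two (A B : SL(2, ℝ)) (i j : Fin 2) :
    (A * B) i j = A i 0 * B 0 j + A i 1 * B 1 j := by
  rw [Matrix.SpecialLinearGroup.coe_mul, Matrix.mul_apply, Fin.sum_univ_two]

lemma det_eq_one_two (A : SL(2, ℝ)) : A 0 0 * A 1 1 - A 0 1 * A 1 0 = 1 := by
  rw [← Matrix.det_fin_two, A.det_coe]

lemma ext_two {A B : SL(2, ℝ)} (h00 : A 0 0 = B 0 0) (h01 : A 0 1 = B 0 1)
    (h10 : A 1 0 = B 1 0) (h11 : A 1 1 = B 1 1) : A = B := by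
  ext i j
  fin_cases i <;> fin_cases j <;> assumption

lemma upperUni_add (s t : ℝ) : upperUni (s + t) = upperUni s * upperUni t := by
  apply ext_two <;> simp [mul_apply_two, add_comm]

lemma lowerUni_add (s t : ℝ) : lowerUni (s + t) = lowerUni s * lowerUni t := by
  apply ext_two <;> simp [mul_apply_two]

lemma upperUni_zero : upperUni 0 = 1 := by
  apply ext_two <;> simp

lemma lowerUni_zero : lowerUni 0 = 1 := by
  apply ext_two <;> simp

lemma lowerUni_mul_diagExp (s t : ℝ) :
    lowerUni s * diagExp t = diagExp t * lowerUni (Real.exp t * s) := by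
  have h : Real.exp (t / 2) = Real.exp (-t / 2) * Real.exp t := by
    rw [← Real.exp_add]
    ring_nf
  apply ext_two <;> simp [mul_apply_two, h]
  ring

instance : MeasurableSpace SL(2, ℝ) := borel _

instance : BorelSpace SL(2, ℝ) := ⟨rfl⟩

instance : SecondCountableTopology SL(2, ℝ) :=
  haveI : SecondCountableTopology (Matrix (Fin 2) (Fin 2) ℝ) :=
    inferInstanceAs (SecondCountableTopology (Fin 2 → Fin 2 → ℝ))
  Matrix.SpecialLinearGroup.isClosedEmbedding_val.isEmbedding.secondCountableTopology

lemma continuous_entry (i j : Fin 2) : Continuous fun h : SL(2, ℝ) => h i j :=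
  continuous_subtype_val.matrix_elem i j

lemma continuous_of_entries {X : Type*} [TopologicalSpace X] {f : X → SL(2, ℝ)}
    (h00 : Continuous fun x => f x 0 0) (h01 : Continuous fun x => f x 0 1)
    (h10 : Continuous fun x => f x 1 0) (h11 : Continuous fun x => f x 1 1) : Continuous f :=
  Matrix.SpecialLinearGroup.isClosedEmbedding_val.isInducing.continuous_iff.2 <|
    continuous_matrix <| Fin.forall_fin_two.2
      ⟨Fin.forall_fin_two.2 ⟨h00, h01⟩, Fin.forall_fin_two.2 ⟨h10, h11⟩⟩

@[fun_prop]
lemma continuous_upperUni : Continuous upperUni :=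
  continuous_of_entries continuous_const continuous_id continuous_const continuous_const

@[fun_prop]
lemma continuous_lowerUni : Continuous lowerUni :=
  continuous_of_entries continuous_const continuous_const continuous_id continuous_const

@[fun_prop]
lemma continuous_diagExp : Continuous diagExp :=
  continuous_of_entries (by simp only [diagExp_coe]; fun_prop) continuous_const continuous_const
    (by simp only [diagExp_coe]; fun_prop)

/-! ### Haar measure on `SL(2, ℝ)` -/

/-- For `v 1 ≠ 0`, the upper triangular matrix with last column `v`. -/
def columnFrame (v : Fin 2 → ℝ) : SL(2, ℝ) :=
  (if v 1 < 0 then -1 else 1) * (upperUni (v 0 / v 1) * diagExp (-2 * Real.log (v 1)))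

lemma columnFrame_coe {v : Fin 2 → ℝ} (hv : v 1 ≠ 0) :
    (columnFrame v : Matrix (Fin 2) (Fin 2) ℝ) = !![(v 1)⁻¹, v 0; 0, v 1] := by
  have hpos : Real.exp (-(-2 * Real.log (v 1)) / 2) = |v 1| := by
    rw [← Real.exp_log_eq_abs hv]
    ring_nf
  have hneg : Real.exp (-2 * Real.log (v 1) / 2) = |v 1|⁻¹ := by
    rw [← Real.exp_log_eq_abs hv, ← Real.exp_neg]
    ring_nf
  rw [columnFrame, Matrix.SpecialLinearGroup.coe_mul, Matrix.SpecialLinearGroup.coe_mul,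
    upperUni_coe, diagExp_coe, hpos, hneg]
  rcases lt_or_gt_of_ne hv with h | h
  · rw [if_pos h, abs_of_neg h]
    ext i j
    fin_cases i <;> fin_cases j <;> simp [hv, inv_neg]
  · rw [if_neg h.not_gt, abs_of_pos h]
    ext i j
    fin_cases i <;> fin_cases j <;> simp [hv]

/-- Coordinates on the set of `h` with `h 1 1 ≠ 0`: the last column of `h`, and the unstable
horocycle time from `columnFrame` of that column to `h`. -/
def columnCoord (p : (Fin 2 → ℝ) × ℝ) : SL(2, ℝ) := columnFrame p.1 * lowerUni p.2

lemma measurable_columnFrame : Measurable columnFrame :=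
  (Measurable.ite (measurableSet_lt (measurable_pi_apply 1) measurable_const)
    measurable_const measurable_const).mul
    ((continuous_upperUni.measurable.comp (by fun_prop)).mul
      (continuous_diagExp.measurable.comp (by fun_prop)))

lemma measurable_columnCoord : Measurable columnCoord :=
  (measurable_columnFrame.comp measurable_fst).mul
    (continuous_lowerUni.measurable.comp measurable_snd)

lemma columnCoord_apply_one_one {p : (Fin 2 → ℝ) × ℝ} (hp : p.1 1 ≠ 0) :
    columnCoord p 1 1 = p.1 1 := by
  simp [columnCoord, mul_apply_two, columnFrame_coe hp]

lemma columnCoord_column {h : SL(2, ℝ)} (hh : h 1 1 ≠ 0) :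
    columnCoord (h.1.col 1, h 1 0 / h 1 1) = h := by
  have hdet := det_eq_one_two h
  have hcol : h.1.col 1 1 ≠ 0 := hh
  apply ext_two <;>
    simp only [columnCoord, mul_apply_two, columnFrame_coe hcol, lowerUni_coe] <;>
    simp [Matrix.col] <;> field_simp
  linear_combination -hdet

/-- The Haar measure of `SL(2, ℝ)`, normalised so that it is `e^{-t} dx dt dr` at
`n(x) a(t) h⁺_r` (see `map_horoCoord`). -/
def haarSL : Measure SL(2, ℝ) := (2 : ℝ≥0∞) • Measure.map columnCoord volume

lemma ae_column_one_ne_zero : ∀ᵐ p : (Fin 2 → ℝ) × ℝ, p.1 1 ≠ 0 :=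
  Measure.quasiMeasurePreserving_fst.ae (Measure.ae_eval_ne _ 1 0)

lemma map_haarSL_eq_self {φ : SL(2, ℝ) → SL(2, ℝ)} (hφ : Measurable φ)
    {ψ : (Fin 2 → ℝ) × ℝ → (Fin 2 → ℝ) × ℝ} (hψ : MeasurePreserving ψ)
    (h : φ ∘ columnCoord =ᵐ[volume] columnCoord ∘ ψ) : haarSL.map φ = haarSL := by
  rw [haarSL, Measure.map_smul, Measure.map_map hφ measurable_columnCoord, Measure.map_congr h,
    ← Measure.map_map measurable_columnCoord hψ.measurable, hψ.map_eq]

lemma ae_haarSL_lowerRight_ne_zero : ∀ᵐ h ∂haarSL, h 1 1 ≠ 0 := by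
  have hmeas : MeasurableSet {h : SL(2, ℝ) | h 1 1 ≠ 0} :=
    ((continuous_entry 1 1).measurable (measurableSet_singleton 0)).compl
  refine Measure.ae_smul_measure ((ae_map_iff measurable_columnCoord.aemeasurable hmeas).2 ?_) _
  filter_upwards [ae_column_one_ne_zero] with p hp
  rwa [columnCoord_apply_one_one hp]

lemma measurePreserving_mulVec (a : SL(2, ℝ)) :
    MeasurePreserving (a.1.mulVec : (Fin 2 → ℝ) → Fin 2 → ℝ) := by
  refine ⟨(Continuous.matrix_mulVec continuous_const continuous_id).measurable, ?_⟩
  have h := Real.map_matrix_volume_pi_eq_smul_volume_pi (M := a.1) (by simp)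
  rw [a.det_coe, inv_one, abs_one, ENNReal.ofReal_one, one_smul] at h
  exact h

instance : haarSL.IsMulLeftInvariant := by
  refine ⟨fun a => ?_⟩
  let c : (Fin 2 → ℝ) → ℝ := fun v => (a * columnFrame v) 1 0 / (a * columnFrame v) 1 1
  have hentry (j : Fin 2) : Measurable fun v => (a * columnFrame v) 1 j :=
    (continuous_entry 1 j).measurable.comp (measurable_columnFrame.const_mul a)
  have hc : Measurable c := (hentry 0).div (hentry 1)
  have hψ : MeasurePreserving (fun p : (Fin 2 → ℝ) × ℝ => (a.1.mulVec p.1, p.2 + c p.1)) :=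
    (measurePreserving_mulVec a).skew_product (g := fun v s => s + c v)
      (measurable_snd.add (hc.comp measurable_fst))
      (Filter.Eventually.of_forall fun v => (measurePreserving_add_right volume (c v)).map_eq)
  refine map_haarSL_eq_self (by fun_prop) hψ ?_
  filter_upwards [ae_column_one_ne_zero, hψ.quasiMeasurePreserving.ae ae_column_one_ne_zero]
    with p hp hp'
  have hcol : (a * columnFrame p.1).1.col 1 = a.1.mulVec p.1 := by
    ext i
    fin_cases i <;> simp [Matrix.col, Matrix.mul_apply, columnFrame_coe hp, Matrix.mulVec,
      dotProduct]
  have hne : (a * columnFrame p.1) 1 1 ≠ 0 := (congrFun hcol 1).trans_ne hp'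
  have hframe : columnFrame (a.1.mulVec p.1) * lowerUni (c p.1) = a * columnFrame p.1 :=
    hcol ▸ columnCoord_column hne
  simp only [Function.comp_apply, columnCoord]
  rw [add_comm, lowerUni_add, ← mul_assoc, ← mul_assoc, hframe]

lemma map_mul_lowerUni_haarSL (s : ℝ) : haarSL.map (· * lowerUni s) = haarSL := by
  have hψ : MeasurePreserving (Prod.map (id : (Fin 2 → ℝ) → Fin 2 → ℝ) (· + s)) :=
    (MeasurePreserving.id volume).prod (measurePreserving_add_right volume s)
  refine map_haarSL_eq_self (by fun_prop) hψ (.of_forall fun p => ?_)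
  simp only [Function.comp_apply, columnCoord, mul_assoc, lowerUni_add, Prod.map, id]

lemma columnFrame_mul_diagExp {v : Fin 2 → ℝ} (hv : v 1 ≠ 0) (t : ℝ) :
    columnFrame v * diagExp t = columnFrame (Real.exp (-t / 2) • v) := by
  have hv' : (Real.exp (-t / 2) • v) 1 ≠ 0 := mul_ne_zero (Real.exp_ne_zero _) hv
  have hexp : Real.exp (t / 2) = (Real.exp (-t / 2))⁻¹ := by
    rw [← Real.exp_neg]
    ring_nf
  apply ext_two <;> rw [columnFrame_coe hv', mul_apply_two, columnFrame_coe hv] <;>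
    simp [hexp, mul_comm]

lemma map_mul_diagExp_haarSL (t : ℝ) : haarSL.map (· * diagExp t) = haarSL := by
  have hψ : MeasurePreserving (Prod.map (fun v : Fin 2 → ℝ => Real.exp (-t / 2) • v)
      (fun r : ℝ => Real.exp t * r)) := by
    refine ⟨by fun_prop, ?_⟩
    have hv : |(Real.exp (-t / 2) ^ Module.finrank ℝ (Fin 2 → ℝ))⁻¹| = Real.exp t := by
      rw [Module.finrank_fin_fun, ← Real.exp_nat_mul, ← Real.exp_neg, Real.abs_exp]
      ring_nf
    have hr : |(Real.exp t)⁻¹| = Real.exp (-t) := by rw [← Real.exp_neg, Real.abs_exp]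
    rw [Measure.volume_eq_prod, ← Measure.map_prod_map _ _ (by fun_prop) (by fun_prop),
      Measure.map_addHaar_smul _ (Real.exp_ne_zero _),
      Real.map_volume_mul_left (Real.exp_ne_zero _), hv, hr, Measure.prod_smul_left,
      Measure.prod_smul_right, smul_smul, ← ENNReal.ofReal_mul (Real.exp_nonneg _),
      ← Real.exp_add, add_neg_cancel, Real.exp_zero, ENNReal.ofReal_one, one_smul]
  refine map_haarSL_eq_self (by fun_prop) hψ ?_
  filter_upwards [ae_column_one_ne_zero] with p hp
  simp only [Function.comp_apply, columnCoord, mul_assoc, lowerUni_mul_diagExp]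
  rw [← mul_assoc, columnFrame_mul_diagExp hp]
  rfl

/-! ### Horospherical coordinates -/

/-- The horospherical coordinates: `horoCoord (x, t, r)` is reached from `n(x) a(t)` by following
the unstable horocycle flow for time `r`. -/
def horoCoord (p : ℝ × ℝ × ℝ) : SL(2, ℝ) := upperUni p.1 * diagExp p.2.1 * lowerUni (-p.2.2)

lemma horoCoord_coe (x t r : ℝ) : (horoCoord (x, t, r) : Matrix (Fin 2) (Fin 2) ℝ) =
    !![Real.exp (t / 2) - x * Real.exp (-t / 2) * r, x * Real.exp (-t / 2);
      -Real.exp (-t / 2) * r, Real.exp (-t / 2)] := by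
  simp [horoCoord, sub_eq_add_neg]

lemma continuous_horoCoord : Continuous horoCoord := by
  unfold horoCoord
  fun_prop

lemma horoCoord_entries {h : SL(2, ℝ)} (hh : 0 < h 1 1) :
    horoCoord (h 0 1 / h 1 1, -2 * Real.log (h 1 1), -(h 1 0 / h 1 1)) = h := by
  have hexp : Real.exp (-(-2 * Real.log (h 1 1)) / 2) = h 1 1 := by
    rw [show -(-2 * Real.log (h 1 1)) / 2 = Real.log (h 1 1) by ring, Real.exp_log hh]
  have hexp' : Real.exp (-2 * Real.log (h 1 1) / 2) = (h 1 1)⁻¹ := by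
    rw [show -2 * Real.log (h 1 1) / 2 = -Real.log (h 1 1) by ring, Real.exp_neg, Real.exp_log hh]
  have hdet := det_eq_one_two h
  apply ext_two <;> rw [horoCoord_coe, hexp, hexp'] <;> simp <;> field_simp
  linear_combination -hdet

lemma horoCoord_injective : Function.Injective horoCoord := by
  rintro ⟨x, t, r⟩ ⟨x', t', r'⟩ h
  have hentry (i j : Fin 2) := congrFun₂ (congrArg Subtype.val h) i j
  simp only [horoCoord_coe] at hentry
  obtain rfl : t = t' := by simpa using hentry 1 1
  simpa using And.intro (hentry 0 1) (hentry 1 0)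

lemma measurableEmbedding_horoCoord : MeasurableEmbedding horoCoord :=
  continuous_horoCoord.measurableEmbedding horoCoord_injective

lemma lintegral_fin_two {f : (Fin 2 → ℝ) → ℝ≥0∞} (hf : Measurable f) :
    ∫⁻ v, f v = ∫⁻ d : ℝ, ∫⁻ b : ℝ, f ![b, d] := by
  rw [← (volume_preserving_finTwoArrow ℝ).symm.lintegral_comp hf, Measure.volume_eq_prod,
    lintegral_prod_symm]
  · rfl
  · exact (hf.comp (MeasurableEquiv.finTwoArrow.symm.measurable)).aemeasurable

lemma lintegral_Ioi_eq_lintegral_exp {a : ℝ} (ha : a ≠ 0) (f : ℝ → ℝ≥0∞) :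
    ∫⁻ y in Ioi (0 : ℝ), f y =
      ∫⁻ t : ℝ, ENNReal.ofReal (|a| * Real.exp (a * t)) * f (Real.exp (a * t)) := by
  have himage : (fun t : ℝ => Real.exp (a * t)) '' univ = Ioi 0 := by
    rw [image_univ, ← Real.range_exp]
    exact (mul_left_surjective₀ ha).range_comp Real.exp
  have hderiv (t : ℝ) (_ : t ∈ univ) :
      HasDerivWithinAt (fun t : ℝ => Real.exp (a * t)) (Real.exp (a * t) * a) univ t := by
    simpa only [id, mul_one] using (((hasDerivAt_id t).const_mul a).exp).hasDerivWithinAt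
  have hinj : InjOn (fun t : ℝ => Real.exp (a * t)) univ :=
    (Real.exp_injective.comp (mul_right_injective₀ ha)).injOn
  rw [← himage, lintegral_image_eq_lintegral_abs_deriv_mul .univ hderiv hinj, setLIntegral_univ]
  simp only [abs_mul, Real.abs_exp, mul_comm]

lemma lintegral_eq_ofReal_abs_mul_lintegral_mul {a : ℝ} (ha : a ≠ 0) {f : ℝ → ℝ≥0∞}
    (hf : Measurable f) : ∫⁻ y, f y = ENNReal.ofReal |a| * ∫⁻ x, f (x * a) := by
  rw [← lintegral_map hf (measurable_mul_const a), ← smul_eq_mul, ← lintegral_smul_measure,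
    Real.smul_map_volume_mul_right ha]

lemma columnCoord_exp (x t r : ℝ) :
    columnCoord (![x * Real.exp (-1 / 2 * t), Real.exp (-1 / 2 * t)], r) =
      horoCoord (x, t, -r) := by
  have hne : ![x * Real.exp (-1 / 2 * t), Real.exp (-1 / 2 * t)] 1 ≠ 0 := Real.exp_ne_zero _
  have : Real.exp (t / 2) = (Real.exp (-1 / 2 * t))⁻¹ := by
    rw [← Real.exp_neg]
    ring_nf
  have : -t / 2 = -1 / 2 * t := by ring
  apply ext_two <;> rw [horoCoord_coe, columnCoord, mul_apply_two, columnFrame_coe hne] <;> simp [*]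

lemma lintegral_haarSL {f : SL(2, ℝ) → ℝ≥0∞} (hf : Measurable f) :
    ∫⁻ h, f h ∂haarSL = 2 * ∫⁻ d : ℝ, ∫⁻ b : ℝ, ∫⁻ r : ℝ, f (columnCoord (![b, d], r)) := by
  have hmeas : Measurable fun p => f (columnCoord p) := hf.comp measurable_columnCoord
  rw [haarSL, lintegral_smul_measure, smul_eq_mul, lintegral_map hf measurable_columnCoord,
    Measure.volume_eq_prod, lintegral_prod _ hmeas.aemeasurable,
    lintegral_fin_two hmeas.lintegral_prod_right']

lemma measurableSet_lowerRight_pos : MeasurableSet {h : SL(2, ℝ) | 0 < h 1 1} :=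
  measurableSet_lt measurable_const (continuous_entry 1 1).measurable

lemma setLIntegral_haarSL_lowerRight_pos {f : SL(2, ℝ) → ℝ≥0∞} (hf : Measurable f) :
    ∫⁻ h in {h | 0 < h 1 1}, f h ∂haarSL =
      2 * ∫⁻ d in Ioi (0 : ℝ), ∫⁻ b : ℝ, ∫⁻ r : ℝ, f (columnCoord (![b, d], r)) := by
  rw [← lintegral_indicator measurableSet_lowerRight_pos,
    lintegral_haarSL (hf.indicator measurableSet_lowerRight_pos),
    ← lintegral_indicator measurableSet_Ioi]
  congr 1
  refine lintegral_congr_ae ?_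
  filter_upwards [Measure.ae_ne volume 0] with d hd
  have hentry (b r : ℝ) : columnCoord (![b, d], r) 1 1 = d :=
    columnCoord_apply_one_one (p := (![b, d], r)) hd
  by_cases hpos : 0 < d <;> simp [indicator, hentry, hpos]

lemma lintegral_columnCoord_exp {f : SL(2, ℝ) → ℝ≥0∞} (hf : Measurable f) (t : ℝ) :
    ∫⁻ b : ℝ, ∫⁻ r : ℝ, f (columnCoord (![b, Real.exp (-1 / 2 * t)], r)) =
      ENNReal.ofReal (Real.exp (-1 / 2 * t)) * ∫⁻ x : ℝ, ∫⁻ r : ℝ, f (horoCoord (x, t, r)) := by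
  have hmeas : Measurable fun p : ℝ × ℝ => f (columnCoord (![p.1, Real.exp (-1 / 2 * t)], p.2)) :=
    hf.comp (measurable_columnCoord.comp (by fun_prop))
  rw [lintegral_eq_ofReal_abs_mul_lintegral_mul (Real.exp_ne_zero _) hmeas.lintegral_prod_right',
    Real.abs_exp]
  congr 1
  refine lintegral_congr fun x => (lintegral_congr fun r => ?_).trans
    (lintegral_neg_eq_self fun r => f (horoCoord (x, t, r)))
  rw [columnCoord_exp]

/-- The measure `e^{-t} dx dt dr` on the horospherical coordinates. -/
def horoMeasure : Measure (ℝ × ℝ × ℝ) :=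
  volume.withDensity fun p => ENNReal.ofReal (Real.exp (-p.2.1))

lemma lintegral_horoMeasure {f : ℝ × ℝ × ℝ → ℝ≥0∞} (hf : Measurable f) :
    ∫⁻ p, f p ∂horoMeasure =
      ∫⁻ x : ℝ, ∫⁻ t : ℝ, ENNReal.ofReal (Real.exp (-t)) * ∫⁻ r : ℝ, f (x, t, r) := by
  have hmeas : Measurable fun p : ℝ × ℝ × ℝ => ENNReal.ofReal (Real.exp (-p.2.1)) * f p := by
    fun_prop
  rw [horoMeasure, lintegral_withDensity_eq_lintegral_mul _ (by fun_prop) hf]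
  refine (lintegral_prod _ hmeas.aemeasurable).trans (lintegral_congr fun x => ?_)
  refine (lintegral_prod _ (hmeas.comp measurable_prodMk_left).aemeasurable).trans
    (lintegral_congr fun t => ?_)
  exact lintegral_const_mul (f := fun r => f (x, t, r)) (ENNReal.ofReal (Real.exp (-t)))
    (by fun_prop)

lemma lintegral_horoMeasure_symm {f : ℝ × ℝ × ℝ → ℝ≥0∞} (hf : Measurable f) :
    ∫⁻ p, f p ∂horoMeasure =
      ∫⁻ r : ℝ, ∫⁻ t : ℝ, ENNReal.ofReal (Real.exp (-t)) * ∫⁻ x : ℝ, f (x, t, r) := by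
  have hmeas : Measurable fun p : ℝ × ℝ × ℝ => ENNReal.ofReal (Real.exp (-p.2.1)) * f p := by
    fun_prop
  rw [horoMeasure, lintegral_withDensity_eq_lintegral_mul _ (by fun_prop) hf]
  refine (lintegral_prod_symm _ hmeas.aemeasurable).trans
    ((lintegral_prod_symm _ hmeas.lintegral_prod_left'.aemeasurable).trans
      (lintegral_congr fun r => lintegral_congr fun t => ?_))
  exact lintegral_const_mul (f := fun x => f (x, t, r)) (ENNReal.ofReal (Real.exp (-t)))
    (by fun_prop)

lemma map_horoCoord : horoMeasure.map horoCoord = haarSL.restrict {h | 0 < h 1 1} := by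
  refine Measure.ext_of_lintegral _ fun f hf => ?_
  have hmeas : Measurable fun p => f (horoCoord p) := hf.comp continuous_horoCoord.measurable
  have hinner : Measurable fun p : ℝ × ℝ =>
      ENNReal.ofReal (Real.exp (-p.2)) * ∫⁻ r : ℝ, f (horoCoord (p.1, p.2, r)) :=
    Measurable.mul (by fun_prop) (hmeas.comp (by fun_prop :
      Measurable fun q : (ℝ × ℝ) × ℝ => (q.1.1, q.1.2, q.2))).lintegral_prod_right'
  rw [lintegral_map hf continuous_horoCoord.measurable, lintegral_horoMeasure hmeas,
    lintegral_lintegral_swap hinner.aemeasurable, setLIntegral_haarSL_lowerRight_pos hf,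
    lintegral_Ioi_eq_lintegral_exp (a := -1 / 2) (by norm_num),
    ← lintegral_const_mul' _ _ (by simp)]
  refine lintegral_congr fun t => ?_
  rw [lintegral_columnCoord_exp hf, lintegral_const_mul' _ _ ENNReal.ofReal_ne_top, ← mul_assoc,
    ← mul_assoc]
  congr 1
  rw [← ENNReal.ofReal_ofNat, ← ENNReal.ofReal_mul (by norm_num),
    ← ENNReal.ofReal_mul (by positivity)]
  congr 1
  rw [show -t = -1 / 2 * t + -1 / 2 * t by ring, Real.exp_add]
  norm_num
  ring

/-! ### Haar measure and hyperbolic area -/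

lemma smul_I_coe (h : SL(2, ℝ)) : (↑(h • UpperHalfPlane.I) : ℂ) =
    (h 0 0 * Complex.I + h 0 1) / (h 1 0 * Complex.I + h 1 1) := by
  simp [UpperHalfPlane.coe_specialLinearGroup_apply]

lemma upperUni_mul_diagExp_smul_I (x t : ℝ) :
    (↑((upperUni x * diagExp t) • UpperHalfPlane.I) : ℂ) = ⟨x, Real.exp t⟩ := by
  have hexp : Real.exp (t / 2) = Real.exp t * Real.exp (-t / 2) := by
    rw [← Real.exp_add]
    ring_nf
  have : (Real.exp (-t / 2) : ℂ) ≠ 0 := Complex.ofReal_ne_zero.2 (Real.exp_ne_zero _)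
  rw [smul_I_coe, Complex.mk_eq_add_mul_I]
  simp only [mul_apply_two, upperUni_coe, diagExp_coe]
  simp [hexp, -Complex.ofReal_exp]
  field_simp
  ring

lemma horoCoord_smul_I (x t r : ℝ) : horoCoord (x, t, r) • UpperHalfPlane.I =
    (upperUni (x - Real.exp t * r / (1 + r ^ 2)) * diagExp (t - Real.log (1 + r ^ 2))) •
      UpperHalfPlane.I := by
  have hr : 0 < 1 + r ^ 2 := by positivity
  have hexp : Real.exp (t / 2) = Real.exp t * Real.exp (-t / 2) := by
    rw [← Real.exp_add]
    ring_nf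
  have : (Real.exp (-t / 2) : ℂ) ≠ 0 := Complex.ofReal_ne_zero.2 (Real.exp_ne_zero _)
  have hden : (-(r * Complex.I) + 1 : ℂ) ≠ 0 := fun h => by simpa using congrArg Complex.re h
  have hden' : (1 + r ^ 2 : ℂ) ≠ 0 := by exact_mod_cast hr.ne'
  apply UpperHalfPlane.ext
  rw [upperUni_mul_diagExp_smul_I, smul_I_coe, horoCoord_coe, Real.exp_sub, Real.exp_log hr,
    Complex.mk_eq_add_mul_I]
  simp [hexp, -Complex.ofReal_exp]
  field_simp
  linear_combination Real.exp t * r * Complex.I_sq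

lemma continuous_upperUni_mul_diagExp_smul_I : Continuous fun p : ℝ × ℝ =>
    (upperUni p.1 * diagExp p.2) • UpperHalfPlane.I := by
  fun_prop

lemma indicator_coe_image_mk (B : Set ℍ) (x t : ℝ) :
    (UpperHalfPlane.coe '' B).indicator (fun z => (((1 / ‖z.im‖₊) ^ 2 : NNReal) : ℝ≥0∞))
        ⟨x, Real.exp t⟩ =
      ENNReal.ofReal (Real.exp (-2 * t)) *
        B.indicator 1 ((upperUni x * diagExp t) • UpperHalfPlane.I) := by
  have hdensity : ((1 / ‖Real.exp t‖₊) ^ 2 : NNReal) = (Real.exp (-2 * t)).toNNReal := by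
    refine NNReal.eq ?_
    rw [Real.coe_toNNReal _ (Real.exp_nonneg _), neg_mul, Real.exp_neg, two_mul, Real.exp_add]
    simp [sq]
  rw [← upperUni_mul_diagExp_smul_I]
  by_cases hmem : (upperUni x * diagExp t) • UpperHalfPlane.I ∈ B
  · rw [indicator_of_mem hmem, indicator_of_mem (mem_image_of_mem _ hmem),
      upperUni_mul_diagExp_smul_I, hdensity, Pi.one_apply, mul_one, ENNReal.ofReal]
  · rw [indicator_of_notMem hmem, mul_zero, indicator_of_notMem]
    rwa [UpperHalfPlane.coe_injective.mem_set_image]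

lemma volume_upperHalfPlane_eq_lintegral {B : Set ℍ} (hB : MeasurableSet B) :
    volume B = ∫⁻ t : ℝ, ENNReal.ofReal (Real.exp (-t)) *
      ∫⁻ x : ℝ, B.indicator 1 ((upperUni x * diagExp t) • UpperHalfPlane.I) := by
  have himage : MeasurableSet (UpperHalfPlane.coe '' B) :=
    UpperHalfPlane.measurableEmbedding_coe.measurableSet_image.2 hB
  let f : ℂ → ℝ≥0∞ := (UpperHalfPlane.coe '' B).indicator fun z => ((1 / ‖z.im‖₊) ^ 2 : NNReal)
  have hf : Measurable f := Measurable.indicator (by fun_prop) himage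
  have hlower (y : ℝ) (hy : y ∉ Ioi (0 : ℝ)) : ∫⁻ x : ℝ, f ⟨x, y⟩ = 0 := by
    refine lintegral_eq_zero_of_ae_eq_zero (.of_forall fun x => indicator_of_notMem ?_ _)
    rintro ⟨z, -, hz⟩
    exact hy (z.im_pos.trans_eq (congrArg Complex.im hz))
  have hupper (t : ℝ) : ENNReal.ofReal (|1| * Real.exp (1 * t)) *
      ∫⁻ x : ℝ, f ⟨x, Real.exp (1 * t)⟩ = ENNReal.ofReal (Real.exp (-t)) *
        ∫⁻ x : ℝ, B.indicator 1 ((upperUni x * diagExp t) • UpperHalfPlane.I) := by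
    simp only [f, one_mul, abs_one, indicator_coe_image_mk]
    rw [lintegral_const_mul' _ _ ENNReal.ofReal_ne_top, ← mul_assoc,
      ← ENNReal.ofReal_mul (Real.exp_nonneg _), ← Real.exp_add]
    ring_nf
  calc volume B = ∫⁻ z, f z := by
        rw [UpperHalfPlane.volume_eq_lintegral, lintegral_indicator himage]
    _ = ∫⁻ p : ℝ × ℝ, f ⟨p.1, p.2⟩ :=
        (Complex.volume_preserving_equiv_real_prod.symm.lintegral_comp hf).symm
    _ = ∫⁻ y : ℝ, ∫⁻ x : ℝ, f ⟨x, y⟩ := lintegral_prod_symm _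
        (hf.comp Complex.measurableEquivRealProd.symm.measurable).aemeasurable
    _ = ∫⁻ y in Ioi (0 : ℝ), ∫⁻ x : ℝ, f ⟨x, y⟩ :=
        (setLIntegral_eq_of_support_subset (Function.support_subset_iff'.2 hlower)).symm
    _ = _ := by
        rw [lintegral_Ioi_eq_lintegral_exp one_ne_zero]
        exact lintegral_congr hupper

lemma lintegral_inv_one_add_sq :
    ∫⁻ r : ℝ, ENNReal.ofReal (1 + r ^ 2)⁻¹ = ENNReal.ofReal Real.pi := by
  rw [← integral_univ_inv_one_add_sq, ofReal_integral_eq_lintegral_ofReal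
    integrable_inv_one_add_sq (.of_forall fun r => by positivity)]

lemma lintegral_exp_neg_mul_sub {φ : ℝ → ℝ≥0∞} (hφ : Measurable φ) (c : ℝ) :
    ∫⁻ t : ℝ, ENNReal.ofReal (Real.exp (-t)) * φ (t - c) =
      ENNReal.ofReal (Real.exp (-c)) * ∫⁻ t : ℝ, ENNReal.ofReal (Real.exp (-t)) * φ t := by
  rw [← lintegral_const_mul _ (by fun_prop), ← lintegral_add_right_eq_self _ c]
  refine lintegral_congr fun t => ?_
  rw [add_sub_cancel_right, ← mul_assoc, ← ENNReal.ofReal_mul (Real.exp_nonneg _),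
    ← Real.exp_add, neg_add_rev]

lemma haarSL_smul_I_mem {B : Set ℍ} (hB : MeasurableSet B) :
    haarSL {h | h • UpperHalfPlane.I ∈ B ∧ 0 < h 1 1} = ENNReal.ofReal Real.pi * volume B := by
  have hact : Measurable fun h : SL(2, ℝ) => h • UpperHalfPlane.I :=
    (continuous_id.smul continuous_const).measurable
  let χ : ℍ → ℝ≥0∞ := B.indicator 1
  have hχ : Measurable χ := measurable_one.indicator hB
  let φ : ℝ → ℝ≥0∞ := fun t =>
    ∫⁻ x : ℝ, χ ((upperUni x * diagExp t) • UpperHalfPlane.I)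
  have hφ : Measurable φ :=
    (hχ.comp continuous_upperUni_mul_diagExp_smul_I.measurable).lintegral_prod_left'
  have hmeas : Measurable fun p => χ (horoCoord p • UpperHalfPlane.I) :=
    hχ.comp (hact.comp continuous_horoCoord.measurable)
  have htrans (t r : ℝ) : ∫⁻ x : ℝ, χ (horoCoord (x, t, r) • UpperHalfPlane.I) =
      φ (t - Real.log (1 + r ^ 2)) := by
    simp only [horoCoord_smul_I]
    exact lintegral_sub_right_eq_self (fun x => χ
      ((upperUni x * diagExp (t - Real.log (1 + r ^ 2))) • UpperHalfPlane.I)) _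
  have hshift (r : ℝ) :
      ∫⁻ t : ℝ, ENNReal.ofReal (Real.exp (-t)) * φ (t - Real.log (1 + r ^ 2)) =
        ENNReal.ofReal (1 + r ^ 2)⁻¹ * volume B := by
    rw [lintegral_exp_neg_mul_sub hφ, Real.exp_neg, Real.exp_log (by positivity),
      volume_upperHalfPlane_eq_lintegral hB]
  calc haarSL {h | h • UpperHalfPlane.I ∈ B ∧ 0 < h 1 1}
      = ∫⁻ h in {h | 0 < h 1 1}, χ (h • UpperHalfPlane.I) ∂haarSL := by
        rw [ofPred_and]
        exact (Measure.restrict_apply (hact hB)).symm.trans (lintegral_indicator_one (hact hB)).symm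
    _ = ∫⁻ p, χ (horoCoord p • UpperHalfPlane.I) ∂horoMeasure := by
        rw [← map_horoCoord]
        exact lintegral_map (hχ.comp hact) continuous_horoCoord.measurable
    _ = ∫⁻ r : ℝ, ∫⁻ t : ℝ, ENNReal.ofReal (Real.exp (-t)) * φ (t - Real.log (1 + r ^ 2)) := by
        simp only [lintegral_horoMeasure_symm hmeas, htrans]
    _ = ENNReal.ofReal Real.pi * volume B := by
        simp only [hshift]
        rw [lintegral_mul_const _ (by fun_prop), lintegral_inv_one_add_sq]

/-- The matrices with positive lower right entry that map `i` into `F`. Each point of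
`SL(2,ℝ)/{±1}` over `F` off a null set has exactly one such representative. -/
def halfLift (F : Set ℍ) : Set SL(2, ℝ) := {h | h • UpperHalfPlane.I ∈ F ∧ 0 < h 1 1}

lemma neg_smul_upperHalfPlane (h : SL(2, ℝ)) (z : ℍ) : -h • z = h • z :=
  (congrArg (· • z) (Units.ext rfl)).trans (UpperHalfPlane.neg_smul (h : GL (Fin 2) ℝ) z)

lemma neg_mem_halfLift {F : Set ℍ} {h : SL(2, ℝ)} :
    -h ∈ halfLift F ↔ h • UpperHalfPlane.I ∈ F ∧ h 1 1 < 0 := by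
  rw [halfLift, mem_ofPred_eq, neg_smul_upperHalfPlane]
  simp

lemma quasiMeasurePreserving_smul_I :
    Measure.QuasiMeasurePreserving (fun h : SL(2, ℝ) => h • UpperHalfPlane.I) haarSL volume := by
  have hact : Measurable fun h : SL(2, ℝ) => h • UpperHalfPlane.I :=
    (continuous_id.smul continuous_const).measurable
  refine ⟨hact, Measure.AbsolutelyContinuous.mk fun B hB hB0 => ?_⟩
  have hpos : haarSL (halfLift B) = 0 := (haarSL_smul_I_mem hB).trans (by rw [hB0, mul_zero])
  have hneg : haarSL ((fun h => -1 * h) ⁻¹' halfLift B) = 0 := by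
    rw [measure_preimage_mul, hpos]
  rw [Measure.map_apply hact hB, ← compl_mem_ae_iff]
  filter_upwards [compl_mem_ae_iff.2 hpos, compl_mem_ae_iff.2 hneg, ae_haarSL_lowerRight_ne_zero]
    with h hpos hneg hne hB
  rcases hne.lt_or_gt with hlt | hgt
  · exact hneg (show -1 * h ∈ halfLift B by rw [neg_one_mul]; exact neg_mem_halfLift.2 ⟨hB, hlt⟩)
  · exact hpos ⟨hB, hgt⟩

lemma haarSL_halfLift {F : Set ℍ} (hF : NullMeasurableSet F) :
    haarSL (halfLift F) = ENNReal.ofReal Real.pi * volume F := by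
  obtain ⟨B, -, hB, hBF⟩ := hF.exists_measurable_superset_ae_eq
  rw [← measure_congr hBF, ← haarSL_smul_I_mem hB]
  exact measure_congr ((quasiMeasurePreserving_smul_I.preimage_ae_eq hBF.symm).inter .rfl)

lemma eq_one_or_eq_neg_one_of_smul {a : SL(2, ℝ)} (ha : ∀ z : ℍ, a • z = z) : a = 1 ∨ a = -1 := by
  obtain ⟨c, hc⟩ := Matrix.GeneralLinearGroup.mem_center_iff_val_mem_range_scalar.1
    (UpperHalfPlane.forall_smul_eq_self_iff_mem_center.1 ha)
  have hentry (i j : Fin 2) := congrFun₂ hc i j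
  have h01 : a 0 1 = 0 := by simpa using (hentry 0 1).symm
  have h10 : a 1 0 = 0 := by simpa using (hentry 1 0).symm
  have h11 : a 1 1 = a 0 0 := by simpa using (hentry 1 1).symm.trans (hentry 0 0)
  have hdet := det_eq_one_two a
  rw [h01, h11, zero_mul, sub_zero] at hdet
  refine (mul_self_eq_one_iff.1 hdet).imp (fun h00 => ?_) fun h00 => ?_ <;>
    apply ext_two <;> simp [h00, h01, h10, h11]

variable {Γ : Subgroup SL(2, ℝ)}

lemma isFundamentalDomain_halfLift [Countable Γ] (hneg : (-1 : SL(2, ℝ)) ∈ Γ) {F : Set ℍ}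
    (hF : IsFundDomain Γ F) : IsFundamentalDomain Γ (halfLift F) haarSL := by
  refine IsFundamentalDomain.mk'' ?_ ?_ (fun γ hγ => ?_)
    fun γ => (measurePreserving_smul γ haarSL).quasiMeasurePreserving
  · exact (hF.nullMeasurableSet.preimage quasiMeasurePreserving_smul_I).inter
      measurableSet_lowerRight_pos.nullMeasurableSet
  · have hne : ∀ᵐ h ∂haarSL, ∀ γ : Γ, (γ • h) 1 1 ≠ 0 := ae_all_iff.2 fun γ =>
      (measurePreserving_smul γ haarSL).quasiMeasurePreserving.ae ae_haarSL_lowerRight_ne_zero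
    filter_upwards [quasiMeasurePreserving_smul_I.ae hF.ae_covers, hne]
      with h ⟨⟨_, γ, hγ, rfl⟩, hmem⟩ hne
    replace hmem : (γ * h) • UpperHalfPlane.I ∈ F := by rwa [mul_smul]
    rcases (hne ⟨γ, hγ⟩).lt_or_gt with hlt | hgt
    · refine ⟨⟨-1 * γ, Γ.mul_mem hneg hγ⟩, ?_⟩
      change -1 * γ * h ∈ halfLift F
      rw [neg_one_mul, neg_mul]
      exact neg_mem_halfLift.2 ⟨hmem, hlt⟩
    · exact ⟨⟨γ, hγ⟩, hmem, hgt⟩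
  by_cases hact : MulAction.toPermHom SL(2, ℝ) ℍ γ = 1
  · have hγ_eq : (γ : SL(2, ℝ)) = -1 := by
      refine (eq_one_or_eq_neg_one_of_smul fun z => ?_).resolve_left fun h => hγ (Subtype.ext h)
      exact congrArg (fun e : Equiv.Perm ℍ => e z) hact
    refine Disjoint.aedisjoint (disjoint_left.2 ?_)
    rintro _ ⟨h, hh, rfl⟩ hγh
    have hγh' : -h ∈ halfLift F := by
      rwa [← neg_one_mul, ← hγ_eq]
    exact lt_asymm hh.2 (neg_mem_halfLift.1 hγh').2
  · have hdisj := hF.aedisjoint (i := ⟨_, mem_image_of_mem _ γ.2⟩) (j := 1)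
      fun h => hact (congrArg Subtype.val h)
    refine measure_mono_null ?_ (quasiMeasurePreserving_smul_I.preimage_null hdisj)
    rintro _ ⟨⟨h, hh, rfl⟩, hγh⟩
    refine ⟨⟨h • UpperHalfPlane.I, hh.1, ?_⟩, ⟨_, hγh.1, one_smul _ _⟩⟩
    exact (mul_smul (γ : SL(2, ℝ)) h UpperHalfPlane.I).symm

/-! ### Cusp vectors -/

lemma countable_of_discreteTopology [DiscreteTopology Γ] : Countable Γ :=
  TopologicalSpace.separableSpace_iff_countable.1 inferInstance

lemma finite_inter_of_discreteTopology [DiscreteTopology Γ] {C : Set SL(2, ℝ)} (hC : IsCompact C) :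
    (Γ ∩ C : Set SL(2, ℝ)).Finite := by
  have h := (Subgroup.tendsto_coe_cofinite_of_discrete Γ ⟨inferInstance⟩).eventually
    hC.compl_mem_cocompact
  refine ((Filter.eventually_cofinite.1 h).image Subtype.val).subset ?_
  rintro γ ⟨hγ, hγC⟩
  exact ⟨⟨γ, hγ⟩, not_not.2 hγC, rfl⟩

/-- The conjugate `m⁻¹ n(1) m` of `n(1)` by any `m` in `SL(2, ℝ)` with lower row `w`. It encodes
a cusp vector, up to sign, by a parabolic element of `Γ`. -/
def parabolic (w : Fin 2 → ℝ) : SL(2, ℝ) :=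
  ⟨!![1 + w 0 * w 1, w 1 ^ 2; -w 0 ^ 2, 1 - w 0 * w 1], by
    rw [Matrix.det_fin_two_of]
    ring⟩

lemma conj_upperUni_one (m : SL(2, ℝ)) : m⁻¹ * upperUni 1 * m = parabolic (m.1.row 1) := by
  have hdet := det_eq_one_two m
  rw [mul_assoc, inv_mul_eq_iff_eq_mul]
  apply ext_two <;> rw [mul_apply_two, mul_apply_two] <;>
    simp only [upperUni_coe, parabolic, Matrix.row_apply, Matrix.of_apply, Matrix.cons_val',
      Matrix.cons_val_zero, Matrix.cons_val_one, Matrix.cons_val_fin_one]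
  · linear_combination -m 1 0 * hdet
  · linear_combination -m 1 1 * hdet
  · ring
  · ring

lemma continuous_parabolic : Continuous parabolic := by
  apply continuous_of_entries <;>
    simp only [parabolic, Matrix.of_apply, Matrix.cons_val', Matrix.cons_val_zero,
      Matrix.cons_val_one, Matrix.cons_val_fin_one] <;> fun_prop

lemma finite_preimage_parabolic (b : SL(2, ℝ)) : (parabolic ⁻¹' {b}).Finite := by
  have hsq (c : ℝ) : {x : ℝ | x ^ 2 = c}.Finite := by
    refine (toFinite {√c, -√c}).subset ?_
    rintro x rfl
    exact sq_eq_sq_iff_eq_or_eq_neg.1 (Real.sq_sqrt (sq_nonneg x)).symm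
  refine (Finite.pi' fun i => hsq (![-b 1 0, b 0 1] i)).subset ?_
  rintro w rfl
  exact Fin.forall_fin_two.2 ⟨(neg_neg _).symm, rfl⟩

variable {K : ℕ} {g : Fin K → SL(2, ℝ)} {σ : Fin K → ℝ}

/-- The union `⋃_ℓ e^{σ_ℓ/2} P^ℓ_Γ h`, which records where the unstable horocycle through `Γ h`
meets the section. -/
def cuspVectors (Γ : Subgroup SL(2, ℝ)) (g : Fin K → SL(2, ℝ)) (σ : Fin K → ℝ) (h : SL(2, ℝ)) :
    Set (Fin 2 → ℝ) :=
  ⋃ ℓ, scaledSet (Real.exp (σ ℓ / 2)) (cuspOrbit Γ g ℓ) h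

lemma mem_cuspOrbit {ℓ : Fin K} {p : Fin 2 → ℝ} :
    p ∈ cuspOrbit Γ g ℓ ↔ ∃ γ ∈ Γ, p = (g ℓ * γ).1.row 1 := by
  have hrow (a : SL(2, ℝ)) : Matrix.vecMul ![0, 1] a.1 = a.1.row 1 := by
    ext i
    simp [Matrix.vecMul, dotProduct]
  simp only [cuspOrbit, mem_ofPred_eq, hrow]

lemma mem_cuspVectors {h : SL(2, ℝ)} {u : Fin 2 → ℝ} : u ∈ cuspVectors Γ g σ h ↔
    ∃ ℓ, ∃ γ ∈ Γ, Real.exp (σ ℓ / 2) • (g ℓ * γ * h).1.row 1 = u := by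
  simp only [cuspVectors, scaledSet, mem_iUnion, mem_image, mem_cuspOrbit]
  refine exists_congr fun ℓ => ⟨?_, ?_⟩
  · rintro ⟨_, ⟨γ, hγ, rfl⟩, rfl⟩
    exact ⟨γ, hγ, rfl⟩
  · rintro ⟨γ, hγ, rfl⟩
    exact ⟨_, ⟨γ, hγ, rfl⟩, rfl⟩

lemma cuspVectors_mul_right (h m : SL(2, ℝ)) :
    cuspVectors Γ g σ (h * m) = (Matrix.vecMul · m.1) '' cuspVectors Γ g σ h := by
  simp only [cuspVectors, scaledSet, image_iUnion, image_image, Matrix.smul_vecMul,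
    Matrix.vecMul_vecMul, Matrix.SpecialLinearGroup.coe_mul]

lemma neg_mem_cuspVectors (hneg : (-1 : SL(2, ℝ)) ∈ Γ) {h : SL(2, ℝ)} {u : Fin 2 → ℝ}
    (hu : u ∈ cuspVectors Γ g σ h) : -u ∈ cuspVectors Γ g σ h := by
  obtain ⟨ℓ, γ, hγ, rfl⟩ := mem_cuspVectors.1 hu
  refine mem_cuspVectors.2 ⟨ℓ, -1 * γ, Γ.mul_mem hneg hγ, ?_⟩
  ext i
  simp

lemma finite_cuspOrbit_inter [DiscreteTopology Γ] (hg : IsCuspSystem Γ g) (ℓ : Fin K)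
    {C : Set (Fin 2 → ℝ)} (hC : IsCompact C) : (cuspOrbit Γ g ℓ ∩ C).Finite := by
  refine ((finite_inter_of_discreteTopology (Γ := Γ) (hC.image continuous_parabolic)).preimage'
    fun b _ => finite_preimage_parabolic b).subset ?_
  rintro p ⟨hp, hpC⟩
  obtain ⟨γ, hγ, rfl⟩ := mem_cuspOrbit.1 hp
  refine ⟨?_, mem_image_of_mem _ hpC⟩
  have hcusp : (g ℓ)⁻¹ * upperUni 1 * g ℓ ∈ Γ :=
    ((hg.width_one ℓ _).2 ⟨1, Or.inl (by rw [Int.cast_one])⟩).1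
  rw [← conj_upperUni_one]
  simpa [mul_assoc] using Γ.mul_mem (Γ.mul_mem (Γ.inv_mem hγ) hcusp) hγ

lemma finite_scaledSet_inter {P C : Set (Fin 2 → ℝ)} (hC : IsCompact C)
    (hP : ∀ D, IsCompact D → (P ∩ D).Finite) {c : ℝ} (hc : c ≠ 0) (h : SL(2, ℝ)) :
    (scaledSet c P h ∩ C).Finite := by
  have hinv : IsCompact ((fun u => c⁻¹ • Matrix.vecMul u (h⁻¹).1) '' C) :=
    hC.image (by fun_prop)
  refine ((hP _ hinv).image fun p => c • Matrix.vecMul p h.1).subset ?_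
  rintro _ ⟨⟨p, hp, rfl⟩, hmem⟩
  refine ⟨p, ⟨hp, _, hmem, ?_⟩, rfl⟩
  simp only [Matrix.smul_vecMul, Matrix.vecMul_vecMul, inv_smul_smul₀ hc]
  rw [← Matrix.SpecialLinearGroup.coe_mul, mul_inv_cancel, Matrix.SpecialLinearGroup.coe_one,
    Matrix.vecMul_one]

lemma finite_cuspVectors_inter [DiscreteTopology Γ] (hg : IsCuspSystem Γ g) (h : SL(2, ℝ))
    {C : Set (Fin 2 → ℝ)} (hC : IsCompact C) : (cuspVectors Γ g σ h ∩ C).Finite := by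
  rw [cuspVectors, iUnion_inter]
  exact finite_iUnion fun ℓ => finite_scaledSet_inter hC
    (fun D hD => finite_cuspOrbit_inter hg ℓ hD) (Real.exp_ne_zero _) h

lemma measurableSet_disjoint_cuspVectors {X : Type*} [MeasurableSpace X] [Countable Γ]
    {f : X → SL(2, ℝ)} (hf : Measurable f) {S : Set (X × (Fin 2 → ℝ))} (hS : MeasurableSet S) :
    MeasurableSet {x | Disjoint (cuspVectors Γ g σ (f x)) {u | (x, u) ∈ S}} := by
  have hEq : {x | Disjoint (cuspVectors Γ g σ (f x)) {u | (x, u) ∈ S}} =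
      ⋂ (ℓ : Fin K) (γ : Γ), {x | (x, Real.exp (σ ℓ / 2) • (g ℓ * γ * f x).1.row 1) ∈ S}ᶜ := by
    ext x
    simp only [disjoint_left, mem_cuspVectors, mem_ofPred_eq, mem_iInter, mem_compl_iff]
    exact ⟨fun hx ℓ γ => hx ⟨ℓ, γ, γ.2, rfl⟩, fun hx u ⟨ℓ, γ, hγ, hu⟩ => hu ▸ hx ℓ ⟨γ, hγ⟩⟩
  rw [hEq]
  refine .iInter fun ℓ => .iInter fun γ => MeasurableSet.compl ?_
  refine (measurable_id.prodMk ?_) hS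
  exact measurable_pi_iff.2 fun i =>
    ((continuous_entry 1 i).measurable.comp (hf.const_mul (g ℓ * γ))).const_mul _

/-! ### Visits to the section -/

lemma pt_eq_pt {a b : SL(2, ℝ)} : pt Γ a = pt Γ b ↔ ∃ γ ∈ Γ, γ * a = b := by
  rw [pt, pt, Quotient.eq]
  exact QuotientGroup.rightRel_apply.trans
    ⟨fun h => ⟨_, h, inv_mul_cancel_right b a⟩, fun ⟨γ, hγ, h⟩ => h ▸ by rwa [mul_inv_cancel_right]⟩

/-- The representative `(g κ)⁻¹ n(s) a(t)` of the point `ι(s, t, κ)` of the section. -/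
def sectionPoint (g : Fin K → SL(2, ℝ)) (s t : ℝ) (κ : Fin K) : SL(2, ℝ) :=
  (g κ)⁻¹ * upperUni s * diagExp t

/-- The times at which the orbit of `Γ h` under the unstable horocycle flow meets the section. -/
def hitTimes (Γ : Subgroup SL(2, ℝ)) (g : Fin K → SL(2, ℝ)) (σ : Fin K → ℝ) (h : SL(2, ℝ)) :
    Set ℝ :=
  {r | pt Γ (h * lowerUni (-r)) ∈ totalSection Γ g σ 0}

lemma zero_mem_hitTimes_iff {h : SL(2, ℝ)} : 0 ∈ hitTimes Γ g σ h ↔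
    ∃ κ, ∃ γ ∈ Γ, ∃ s t, σ κ ≤ t ∧ γ * h = sectionPoint g s t κ := by
  have hpt : pt Γ h ∈ totalSection Γ g σ 0 ↔
      ∃ κ, ∃ t, σ κ ≤ t ∧ ∃ s, pt Γ h = pt Γ (sectionPoint g s t κ) := by
    simp only [totalSection, cuspSection, closedHorocycle, mem_iUnion, mem_image, mem_range,
      add_zero, mem_Ici, exists_prop, exists_exists_eq_and, eq_comm (a := pt Γ h)]
    rfl
  rw [hitTimes, mem_ofPred_eq, neg_zero, lowerUni_zero, mul_one, hpt]
  refine exists_congr fun κ => ⟨?_, ?_⟩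
  · rintro ⟨t, ht, s, hs⟩
    obtain ⟨γ, hγ, h⟩ := pt_eq_pt.1 hs
    exact ⟨γ, hγ, s, t, ht, h⟩
  · rintro ⟨γ, hγ, s, t, ht, h⟩
    exact ⟨t, ht, s, pt_eq_pt.2 ⟨γ, hγ, h⟩⟩

lemma exists_eq_upperUni_mul_diagExp_iff {m : SL(2, ℝ)} {c : ℝ} :
    (∃ s t, c ≤ t ∧ m = upperUni s * diagExp t) ↔
      m 1 0 = 0 ∧ 0 < m 1 1 ∧ Real.exp (c / 2) * m 1 1 ≤ 1 := by
  constructor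
  · rintro ⟨s, t, ht, rfl⟩
    have h11 : (upperUni s * diagExp t) 1 1 = Real.exp (-t / 2) := by simp
    refine ⟨by simp, h11 ▸ Real.exp_pos _, ?_⟩
    rw [h11, ← Real.exp_add, Real.exp_le_one_iff]
    linarith
  · rintro ⟨h10, h11, hle⟩
    have hlog : c / 2 + Real.log (m 1 1) ≤ 0 := by
      rw [← Real.exp_le_one_iff, Real.exp_add, Real.exp_log h11]
      exact hle
    refine ⟨m 0 1 / m 1 1, -2 * Real.log (m 1 1), by linarith, ?_⟩
    conv_lhs => rw [← horoCoord_entries h11]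
    simp only [horoCoord, h10, zero_div, neg_zero, lowerUni_zero, mul_one]

/-- The points of the strip `0 < u₂ ≤ 1` whose slope `u₁ / u₂` lies in `I`; for `I = [-r, 0)` it is
the triangle `Δ_{-r}`. -/
def sector (I : Set ℝ) : Set (Fin 2 → ℝ) := {u | 0 < u 1 ∧ u 1 ≤ 1 ∧ u 0 / u 1 ∈ I}

lemma sector_Ico_eq_negTriangle (r : ℝ) : sector (Ico (-r) 0) = negTriangle r := by
  ext u
  simp only [sector, negTriangle, mem_ofPred_eq, mem_Ico]
  constructor
  · rintro ⟨hpos, hle, hr, h0⟩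
    exact ⟨(le_div_iff₀ hpos).1 hr, neg_of_div_neg_left h0 hpos.le, hpos, hle⟩
  · rintro ⟨hr, h0, hpos, hle⟩
    exact ⟨hpos, hle, (le_div_iff₀ hpos).2 hr, div_neg_of_neg_of_pos h0 hpos⟩

lemma zero_mem_hitTimes_iff_nonempty {h : SL(2, ℝ)} :
    0 ∈ hitTimes Γ g σ h ↔ (cuspVectors Γ g σ h ∩ sector {0}).Nonempty := by
  have hsection (κ : Fin K) (γ : SL(2, ℝ)) (s t : ℝ) :
      γ * h = sectionPoint g s t κ ↔ g κ * γ * h = upperUni s * diagExp t := by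
    rw [sectionPoint, mul_assoc, eq_inv_mul_iff_mul_eq, mul_assoc]
  simp only [zero_mem_hitTimes_iff, hsection, exists_eq_upperUni_mul_diagExp_iff]
  have hexp (κ : Fin K) : 0 < Real.exp (σ κ / 2) := Real.exp_pos _
  have hvec (κ : Fin K) (m : SL(2, ℝ)) : Real.exp (σ κ / 2) • m.1.row 1 ∈ sector {0} ↔
      m 1 0 = 0 ∧ 0 < m 1 1 ∧ Real.exp (σ κ / 2) * m 1 1 ≤ 1 := by
    simp only [sector, mem_ofPred_eq, Pi.smul_apply, Matrix.row_apply, smul_eq_mul,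
      mem_singleton_iff, div_eq_zero_iff, mul_eq_zero, (hexp κ).ne', false_or,
      mul_pos_iff_of_pos_left (hexp κ)]
    refine ⟨fun ⟨h0, h1, h⟩ => ⟨h.resolve_right h0.ne', h0, h1⟩,
      fun ⟨h, h0, h1⟩ => ⟨h0, h1, Or.inl h⟩⟩
  constructor
  · rintro ⟨κ, γ, hγ, h⟩
    exact ⟨_, mem_cuspVectors.2 ⟨κ, γ, hγ, rfl⟩, (hvec κ _).2 h⟩
  · rintro ⟨_, hu, hsec⟩
    obtain ⟨κ, γ, hγ, rfl⟩ := mem_cuspVectors.1 hu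
    exact ⟨κ, γ, hγ, (hvec κ _).1 hsec⟩

lemma mem_hitTimes_mul_lowerUni {h : SL(2, ℝ)} {r r' : ℝ} :
    r' ∈ hitTimes Γ g σ (h * lowerUni (-r)) ↔ r + r' ∈ hitTimes Γ g σ h := by
  rw [hitTimes, hitTimes, mem_ofPred_eq, mem_ofPred_eq, mul_assoc, ← lowerUni_add, neg_add]

lemma vecMul_lowerUni_mem_sector_iff {u : Fin 2 → ℝ} {r : ℝ} :
    Matrix.vecMul u (lowerUni (-r)).1 ∈ sector {0} ↔ u ∈ sector {r} := by
  have h0 : Matrix.vecMul u (lowerUni (-r)).1 0 = u 0 - r * u 1 := by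
    simp [Matrix.vecMul, dotProduct]
    ring
  have h1 : Matrix.vecMul u (lowerUni (-r)).1 1 = u 1 := by
    simp [Matrix.vecMul, dotProduct]
  simp only [sector, mem_ofPred_eq, h0, h1, mem_singleton_iff]
  refine and_congr_right fun hpos => and_congr_right fun _ => ?_
  rw [div_eq_zero_iff, or_iff_left hpos.ne', sub_eq_zero, div_eq_iff hpos.ne']

lemma mem_hitTimes_iff {h : SL(2, ℝ)} {r : ℝ} :
    r ∈ hitTimes Γ g σ h ↔ (cuspVectors Γ g σ h ∩ sector {r}).Nonempty := by
  rw [← add_zero r, ← mem_hitTimes_mul_lowerUni, zero_mem_hitTimes_iff_nonempty,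
    cuspVectors_mul_right, add_zero]
  exact exists_mem_image.trans (exists_congr fun u => and_congr_right fun _ =>
    vecMul_lowerUni_mem_sector_iff)

lemma disjoint_hitTimes_iff {h : SL(2, ℝ)} {I : Set ℝ} :
    Disjoint (hitTimes Γ g σ h) I ↔ Disjoint (cuspVectors Γ g σ h) (sector I) := by
  simp only [disjoint_left, mem_hitTimes_iff]
  constructor
  · rintro hdisj u hu ⟨hpos, hle, hI⟩
    exact hdisj ⟨u, hu, hpos, hle, rfl⟩ hI
  · rintro hdisj r ⟨u, hu, hpos, hle, rfl⟩ hI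
    exact hdisj hu ⟨hpos, hle, hI⟩

lemma hitTimes_mul_left {γ : SL(2, ℝ)} (hγ : γ ∈ Γ) (h : SL(2, ℝ)) :
    hitTimes Γ g σ (γ * h) = hitTimes Γ g σ h := by
  ext r
  have hpt : pt Γ (h * lowerUni (-r)) = pt Γ (γ * h * lowerUni (-r)) :=
    pt_eq_pt.2 ⟨γ, hγ, (mul_assoc _ _ _).symm⟩
  simp only [hitTimes, mem_ofPred_eq, hpt]

lemma finite_hitTimes_inter [DiscreteTopology Γ] (hg : IsCuspSystem Γ g) (h : SL(2, ℝ)) (R : ℝ) :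
    (hitTimes Γ g σ h ∩ Icc (-R) R).Finite := by
  refine ((finite_cuspVectors_inter (σ := σ) hg h (isCompact_closedBall 0 (max R 1))).image
    fun u => u 0 / u 1).subset ?_
  rintro r ⟨hr, hrR⟩
  obtain ⟨u, hu, hpos, hle, rfl⟩ := mem_hitTimes_iff.1 hr
  refine ⟨u, ⟨hu, ?_⟩, rfl⟩
  rw [mem_closedBall_zero_iff, pi_norm_le_iff_of_nonneg (zero_le_one.trans (le_max_right _ _)),
    Fin.forall_fin_two]
  have habs : |u 0| ≤ max R 1 * u 1 := by
    rw [← div_le_iff₀ hpos]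
    nth_rewrite 1 [← abs_of_pos hpos]
    rw [← abs_div]
    exact (abs_le.2 hrR).trans (le_max_left _ _)
  refine ⟨habs.trans (mul_le_of_le_one_right (zero_le_one.trans (le_max_right _ _)) hle), ?_⟩
  exact (Real.norm_of_nonneg hpos.le).trans_le (hle.trans (le_max_right _ _))

lemma ofReal_lt_iInf_ofReal_iff {T : Set ℝ} (hT : ∀ R, (T ∩ Icc (-R) R).Finite) {r : ℝ}
    (hr : 0 ≤ r) :
    ENNReal.ofReal r < (⨅ (x : ℝ) (_ : 0 < x) (_ : x ∈ T), ENNReal.ofReal x) ↔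
      Disjoint T (Ioc 0 r) := by
  rw [disjoint_left]
  constructor
  · intro hlt x hxT hx
    exact hlt.not_ge ((iInf₂_le_of_le x hx.1 (iInf_le _ hxT)).trans (ENNReal.ofReal_le_ofReal hx.2))
  · intro hdisj
    have hgap : ∀ᶠ b in 𝓝[>] r, ∀ x ∈ T ∩ Icc (-(r + 1)) (r + 1), r < x → b ≤ x := by
      refine (Filter.eventually_all_finite (hT _)).2 fun x _ => Filter.eventually_imp_distrib_left.2
        fun hrx => ?_
      exact ((eventually_lt_nhds hrx).filter_mono nhdsWithin_le_nhds).mono fun _ => le_of_lt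
    obtain ⟨b, hb, hrb, hbr⟩ :=
      (hgap.and (Ioo_mem_nhdsGT (lt_add_one r))).exists
    refine ((ENNReal.ofReal_lt_ofReal_iff (hr.trans_lt hrb)).2 hrb).trans_le ?_
    refine le_iInf₂ fun x hx => le_iInf fun hxT => ENNReal.ofReal_le_ofReal ?_
    have hrx : r < x := not_le.1 fun hle => hdisj hxT ⟨hx, hle⟩
    rcases le_total x (r + 1) with hle | hle
    · exact hb x ⟨hxT, by linarith, hle⟩ hrx
    · exact hbr.le.trans hle

lemma ofReal_lt_returnTime_iff [DiscreteTopology Γ] (hg : IsCuspSystem Γ g) {r : ℝ} (hr : 0 ≤ r)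
    (s t : ℝ) (κ : Fin K) : ENNReal.ofReal r < returnTime Γ g σ s t κ ↔
      Disjoint (hitTimes Γ g σ (sectionPoint g s t κ)) (Ioc 0 r) :=
  ofReal_lt_iInf_ofReal_iff (finite_hitTimes_inter hg _) hr

lemma ofReal_lt_backReturnTime_iff [DiscreteTopology Γ] (hg : IsCuspSystem Γ g) {r : ℝ}
    (hr : 0 ≤ r) (s t : ℝ) (κ : Fin K) : ENNReal.ofReal r < backReturnTime Γ g σ s t κ ↔
      Disjoint (hitTimes Γ g σ (sectionPoint g s t κ)) (Ico (-r) 0) := by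
  have hfinite (R : ℝ) :
      (Neg.neg ⁻¹' hitTimes Γ g σ (sectionPoint g s t κ) ∩ Icc (-R) R).Finite := by
    refine ((finite_hitTimes_inter (σ := σ) hg (sectionPoint g s t κ) R).preimage
      neg_injective.injOn).subset ?_
    rintro x ⟨hx, hxR⟩
    exact ⟨hx, neg_le_neg hxR.2, neg_le.1 hxR.1⟩
  have hpre : Neg.neg ⁻¹' Ico (-r) 0 = Ioc 0 r := by
    ext x
    simp [and_comm]
  rw [← disjoint_preimage_iff neg_surjective, hpre]
  exact ofReal_lt_iInf_ofReal_iff hfinite hr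

lemma density_eq_prod [DiscreteTopology Γ] (hg : IsCuspSystem Γ g) {r : ℝ} (hr : 0 ≤ r)
    (s t : ℝ) (κ : Fin K) :
    density Γ g σ r s t κ =
      1 / (meanReturnTime Γ g σ).toReal * ∏ ℓ : Fin K,
        emptyIndicator (scaledSet (Real.exp (σ ℓ / 2)) (cuspOrbit Γ g ℓ)
          ((g κ)⁻¹ * upperUni s * diagExp t) ∩ negTriangle r) := by
  have hcond : ENNReal.ofReal r < backReturnTime Γ g σ s t κ ↔
      ∀ ℓ ∈ Finset.univ, scaledSet (Real.exp (σ ℓ / 2)) (cuspOrbit Γ g ℓ)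
        ((g κ)⁻¹ * upperUni s * diagExp t) ∩ negTriangle r = ∅ := by
    rw [ofReal_lt_backReturnTime_iff hg hr, disjoint_hitTimes_iff, sector_Ico_eq_negTriangle,
      cuspVectors, disjoint_iUnion_left]
    simp only [disjoint_iff_inter_eq_empty, Finset.mem_univ, true_imp_iff, sectionPoint]
  simp only [density, emptyIndicator, Finset.prod_boole, hcond]
  congr 1
  split_ifs <;> rfl

/-! ### Recurrence to the section -/

section InvariantSets

variable {G α : Type*} [Group G] [Countable G] [MulAction G α] [MeasurableSpace α]
  [MeasurableConstSMul G α] {μ : Measure α} [SMulInvariantMeasure G α μ] {D A : Set α}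

lemma measure_preimage_inter_isFundamentalDomain (hD : IsFundamentalDomain G D μ) {e : α ≃ᵐ α}
    (he : MeasurePreserving e μ μ) (hcomm : ∀ (γ : G) (x : α), e (γ • x) = γ • e x)
    (hA : MeasurableSet A) (hinv : ∀ γ : G, (γ • ·) ⁻¹' A = A) :
    μ (e ⁻¹' A ∩ D) = μ (A ∩ D) := by
  have hD' : IsFundamentalDomain G (e.symm ⁻¹' D) μ :=
    hD.preimage_of_equiv (he.symm e).quasiMeasurePreserving (e := id) Function.bijective_id
      fun γ x => e.symm_apply_eq.2 (by rw [hcomm, e.apply_symm_apply]; rfl)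
  rw [hD.measure_set_eq hD' hA hinv, ← he.measure_preimage_equiv (A ∩ _), preimage_inter,
    ← preimage_comp, e.symm_comp_self, preimage_id]

lemma measure_eq_zero_of_antitone_preimage (hD : IsFundamentalDomain G D μ) (hfin : μ D ≠ ⊤)
    {e : ℕ → α ≃ᵐ α} (he : ∀ n, MeasurePreserving (e n) μ μ)
    (hcomm : ∀ n (γ : G) (x : α), e n (γ • x) = γ • e n x)
    (hA : MeasurableSet A) (hinv : ∀ γ : G, (γ • ·) ⁻¹' A = A)
    (hanti : Antitone fun n => e n ⁻¹' A) (hzero : μ (⋂ n, e n ⁻¹' A) = 0) : μ A = 0 := by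
  have hlim := tendsto_measure_iInter_atTop (μ := μ) (s := fun n => e n ⁻¹' A ∩ D)
    (fun n => ((e n).measurable hA).nullMeasurableSet.inter hD.nullMeasurableSet)
    (fun _ _ hmn => inter_subset_inter_left _ (hanti hmn))
    ⟨0, measure_ne_top_of_subset inter_subset_right hfin⟩
  have hconst (n : ℕ) : μ (e n ⁻¹' A ∩ D) = μ (A ∩ D) :=
    measure_preimage_inter_isFundamentalDomain hD (he n) (hcomm n) hA hinv
  rw [← iInter_inter, measure_inter_null_of_null_left _ hzero] at hlim
  simp only [Function.comp_def, hconst] at hlim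
  refine hD.measure_zero_of_invariant A (fun γ => ?_) (tendsto_nhds_unique tendsto_const_nhds hlim)
  rw [← preimage_smul_inv, hinv]

end InvariantSets

lemma vecMul_mem_sector_Iic_iff {u : Fin 2 → ℝ} (x : ℝ) {y : ℝ} (hy : 0 < y) :
    Matrix.vecMul u (lowerUni (-x) * diagExp (2 * Real.log y)).1 ∈ sector (Iic 0) ↔
      0 < u 1 ∧ u 1 ≤ y ∧ u 0 / u 1 ≤ x := by
  have hexp : Real.exp (-(2 * Real.log y) / 2) = y⁻¹ := by
    rw [neg_div, mul_div_cancel_left₀ _ two_ne_zero, Real.exp_neg, Real.exp_log hy]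
  have hvec : Matrix.vecMul u (lowerUni (-x) * diagExp (2 * Real.log y)).1 =
      ![(u 0 - x * u 1) * y, u 1 / y] := by
    ext i
    fin_cases i <;> simp [Matrix.vecMul, dotProduct, hexp, Real.exp_log hy] <;> ring
  simp only [hvec, sector, mem_ofPred_eq, Matrix.cons_val_zero, Matrix.cons_val_one, mem_Iic]
  rw [div_pos_iff_of_pos_right hy, div_le_one hy]
  refine and_congr_right fun hpos => and_congr_right fun _ => ?_
  rw [div_le_iff₀ (div_pos hpos hy), zero_mul, div_le_iff₀ hpos, ← sub_nonpos (a := u 0),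
    ← not_lt, ← not_lt, mul_pos_iff_of_pos_right hy]

lemma disjoint_hitTimes_mul_Iic_iff {h : SL(2, ℝ)} (x : ℝ) {y : ℝ} (hy : 0 < y) :
    Disjoint (hitTimes Γ g σ (h * (lowerUni (-x) * diagExp (2 * Real.log y)))) (Iic 0) ↔
      ∀ u ∈ cuspVectors Γ g σ h, ¬ (0 < u 1 ∧ u 1 ≤ y ∧ u 0 / u 1 ≤ x) := by
  rw [disjoint_hitTimes_iff, cuspVectors_mul_right, disjoint_image_left, disjoint_left]
  simp only [mem_preimage, vecMul_mem_sector_Iic_iff _ hy]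

lemma measurePreserving_mulRight_lowerUni_mul_diagExp (s t : ℝ) :
    MeasurePreserving (MeasurableEquiv.mulRight (lowerUni s * diagExp t)) haarSL haarSL := by
  have hlower : MeasurePreserving (· * lowerUni s) haarSL haarSL :=
    ⟨by fun_prop, map_mul_lowerUni_haarSL s⟩
  have hdiag : MeasurePreserving (· * diagExp t) haarSL haarSL :=
    ⟨by fun_prop, map_mul_diagExp_haarSL t⟩
  convert hdiag.comp hlower using 1
  exact funext fun h => (mul_assoc h _ _).symm

lemma measurableSet_sector {I : Set ℝ} (hI : MeasurableSet I) : MeasurableSet (sector I) :=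
  (measurableSet_lt measurable_const (measurable_pi_apply 1)).inter
    ((measurableSet_le (measurable_pi_apply 1) measurable_const).inter
      (((measurable_pi_apply 0).div (measurable_pi_apply 1)) hI))

lemma ae_exists_pos_cuspVectors (hneg : (-1 : SL(2, ℝ)) ∈ Γ) (κ : Fin K) :
    ∀ᵐ h ∂haarSL, ∃ u ∈ cuspVectors Γ g σ h, 0 < u 1 := by
  have hne : ∀ᵐ h ∂haarSL, (g κ * h) 1 1 ≠ 0 :=
    (measurePreserving_mul_left haarSL (g κ)).quasiMeasurePreserving.ae ae_haarSL_lowerRight_ne_zero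
  filter_upwards [hne] with h hh
  have hmem : Real.exp (σ κ / 2) • (g κ * h).1.row 1 ∈ cuspVectors Γ g σ h :=
    mem_cuspVectors.2 ⟨κ, 1, Γ.one_mem, by rw [mul_one]⟩
  rcases hh.lt_or_gt with hlt | hgt
  · exact ⟨_, neg_mem_cuspVectors hneg hmem,
      neg_pos.2 (mul_neg_of_pos_of_neg (Real.exp_pos _) hlt)⟩
  · exact ⟨_, hmem, mul_pos (Real.exp_pos _) hgt⟩

lemma ae_nonempty_hitTimes_inter_Iic [Countable Γ] (hneg : (-1 : SL(2, ℝ)) ∈ Γ) (hK : 0 < K)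
    {D : Set SL(2, ℝ)} (hD : IsFundamentalDomain Γ D haarSL) (hfin : haarSL D ≠ ⊤) :
    ∀ᵐ h ∂haarSL, (hitTimes Γ g σ h ∩ Iic 0).Nonempty := by
  let A : Set SL(2, ℝ) := {h | Disjoint (hitTimes Γ g σ h) (Iic 0)}
  let e (n : ℕ) : SL(2, ℝ) ≃ᵐ SL(2, ℝ) :=
    MeasurableEquiv.mulRight (lowerUni (-n) * diagExp (2 * Real.log (n + 1)))
  have hpre (n : ℕ) (h : SL(2, ℝ)) : h ∈ e n ⁻¹' A ↔
      ∀ u ∈ cuspVectors Γ g σ h, ¬ (0 < u 1 ∧ u 1 ≤ n + 1 ∧ u 0 / u 1 ≤ n) :=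
    disjoint_hitTimes_mul_Iic_iff n n.cast_add_one_pos
  have hA : MeasurableSet A := by
    simp only [A, disjoint_hitTimes_iff]
    exact measurableSet_disjoint_cuspVectors (S := Prod.snd ⁻¹' sector (Iic 0)) measurable_id
      (measurable_snd (measurableSet_sector measurableSet_Iic))
  have hzero : haarSL (⋂ n, e n ⁻¹' A) = 0 := by
    refine measure_mono_null (fun h hh => ?_)
      (ae_exists_pos_cuspVectors (g := g) (σ := σ) hneg ⟨0, hK⟩)
    rintro ⟨u, hu, hpos⟩
    obtain ⟨n, hn⟩ := exists_nat_ge (max (u 1) (u 0 / u 1))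
    exact (hpre n h).1 (mem_iInter.1 hh n) u hu
      ⟨hpos, ((le_max_left _ _).trans hn).trans (le_add_of_nonneg_right zero_le_one),
        (le_max_right _ _).trans hn⟩
  have hnull : haarSL A = 0 := by
    refine measure_eq_zero_of_antitone_preimage hD hfin
      (fun n => measurePreserving_mulRight_lowerUni_mul_diagExp _ _)
      (fun n γ h => mul_assoc (γ : SL(2, ℝ)) h _) hA (fun γ => ?_) ?_ hzero
    · ext h
      exact iff_of_eq (congrArg (Disjoint · _) (hitTimes_mul_left γ.2 h))
    · intro m n hmn h hh
      have hmn' : (m : ℝ) ≤ n := Nat.cast_le.2 hmn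
      refine (hpre m h).2 fun u hu ⟨hpos, hle, hslope⟩ => (hpre n h).1 hh u hu
        ⟨hpos, hle.trans (by linarith), hslope.trans hmn'⟩
  exact (measure_eq_zero_iff_ae_notMem.1 hnull).mono fun _ => not_disjoint_iff_nonempty_inter.1

/-! ### Flow boxes -/

lemma sectionPoint_mul_lowerUni (s t r : ℝ) (κ : Fin K) :
    sectionPoint g s t κ * lowerUni (-r) = (g κ)⁻¹ * horoCoord (s, t, r) := by
  rw [sectionPoint, horoCoord, mul_assoc, mul_assoc, mul_assoc]

lemma isGreatest_hitTimes_iff [DiscreteTopology Γ] (hg : IsCuspSystem Γ g) {s t r : ℝ}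
    {κ : Fin K} (ht : σ κ ≤ t) (hr : 0 ≤ r) :
    IsGreatest (hitTimes Γ g σ (sectionPoint g s t κ * lowerUni (-r)) ∩ Iic 0) (-r) ↔
      ENNReal.ofReal r < returnTime Γ g σ s t κ := by
  have hstart : 0 ∈ hitTimes Γ g σ (sectionPoint g s t κ) :=
    zero_mem_hitTimes_iff.2 ⟨κ, 1, Γ.one_mem, s, t, ht, one_mul _⟩
  simp only [ofReal_lt_returnTime_iff hg hr, IsGreatest, upperBounds, disjoint_left, mem_inter_iff,
    mem_hitTimes_mul_lowerUni, mem_Iic, mem_ofPred_eq, mem_Ioc, add_neg_cancel, hstart]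
  constructor
  · rintro ⟨-, hmax⟩ x hx ⟨hpos, hle⟩
    have hle' := hmax (a := x - r) ⟨by rwa [add_sub_cancel], by linarith⟩
    linarith
  · intro hdisj
    refine ⟨⟨trivial, neg_nonpos.2 hr⟩, fun x ⟨hx, hle⟩ => ?_⟩
    by_contra! hlt
    exact hdisj hx ⟨by linarith, add_le_of_nonpos_right hle⟩

/-- The coordinates `(s, t, r)` of the points `h⁺_r(ι(s, t, κ))` which lie on an orbit segment
between the point `ι(s, t, κ)` of the section and its first return to the section. -/
def flowCoords (Γ : Subgroup SL(2, ℝ)) (g : Fin K → SL(2, ℝ)) (σ : Fin K → ℝ) (κ : Fin K) :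
    Set (ℝ × ℝ × ℝ) :=
  {p | p.1 ∈ Ico 0 1 ∧ σ κ ≤ p.2.1 ∧ 0 ≤ p.2.2 ∧
    ENNReal.ofReal p.2.2 < returnTime Γ g σ p.1 p.2.1 κ}

/-- The matrices with coordinates in `flowCoords` relative to the cusp `κ`. The union of the flow
boxes over all cusps is a fundamental domain for `Γ`. -/
def flowBox (Γ : Subgroup SL(2, ℝ)) (g : Fin K → SL(2, ℝ)) (σ : Fin K → ℝ) (κ : Fin K) :
    Set SL(2, ℝ) :=
  (fun p => (g κ)⁻¹ * horoCoord p) '' flowCoords Γ g σ κ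

lemma mem_flowBox {h : SL(2, ℝ)} {κ : Fin K} : h ∈ flowBox Γ g σ κ ↔
    ∃ s ∈ Ico (0 : ℝ) 1, ∃ t, σ κ ≤ t ∧ ∃ r, 0 ≤ r ∧ ENNReal.ofReal r < returnTime Γ g σ s t κ ∧
      sectionPoint g s t κ * lowerUni (-r) = h := by
  simp only [sectionPoint_mul_lowerUni]
  constructor
  · rintro ⟨⟨s, t, r⟩, ⟨hs, ht, hr, hlt⟩, rfl⟩
    exact ⟨s, hs, t, ht, r, hr, hlt, rfl⟩
  · rintro ⟨s, hs, t, ht, r, hr, hlt, rfl⟩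
    exact ⟨(s, t, r), ⟨hs, ht, hr, hlt⟩, rfl⟩

lemma measurableSet_flowCoords [DiscreteTopology Γ] (hg : IsCuspSystem Γ g) (κ : Fin K) :
    MeasurableSet (flowCoords Γ g σ κ) := by
  have := countable_of_discreteTopology (Γ := Γ)
  let S : Set ((ℝ × ℝ × ℝ) × (Fin 2 → ℝ)) := {q | q.2 ∈ sector (Ioc 0 q.1.2.2)}
  have hS : MeasurableSet S := by
    simp only [S, sector, mem_ofPred_eq, mem_Ioc]
    measurability
  have hpoint : Measurable fun p : ℝ × ℝ × ℝ => sectionPoint g p.1 p.2.1 κ := by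
    unfold sectionPoint
    fun_prop
  have hEq : flowCoords Γ g σ κ = {p | p.1 ∈ Ico 0 1 ∧ σ κ ≤ p.2.1 ∧ 0 ≤ p.2.2} ∩
      {p | Disjoint (cuspVectors Γ g σ (sectionPoint g p.1 p.2.1 κ)) {u | (p, u) ∈ S}} := by
    ext ⟨s, t, r⟩
    simp only [flowCoords, mem_inter_iff, mem_ofPred_eq, and_assoc]
    refine and_congr_right fun _ => and_congr_right fun _ => and_congr_right fun hr => ?_
    rw [ofReal_lt_returnTime_iff hg hr, disjoint_hitTimes_iff]
    rfl
  rw [hEq]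
  exact MeasurableSet.inter (by measurability) (measurableSet_disjoint_cuspVectors hpoint hS)

lemma measurableSet_flowBox [DiscreteTopology Γ] (hg : IsCuspSystem Γ g) (κ : Fin K) :
    MeasurableSet (flowBox Γ g σ κ) :=
  ((MeasurableEquiv.mulLeft (g κ)⁻¹).measurableEmbedding.comp
    measurableEmbedding_horoCoord).measurableSet_image' (measurableSet_flowCoords hg κ)

lemma smul_boundaryPoint_eq_iff (γ : SL(2, ℝ)) (κ κ' : Fin K) :
    Matrix.SpecialLinearGroup.toGL γ • boundaryPoint (g κ) = boundaryPoint (g κ') ↔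
      (g κ' * γ * (g κ)⁻¹) 1 0 = 0 := by
  rw [boundaryPoint, boundaryPoint, ← mul_smul, ← map_mul, map_inv, eq_inv_smul_iff, ← mul_smul,
    ← map_mul, OnePoint.smul_infty_eq_self_iff, mul_assoc]
  rfl

lemma isParabolic_parabolic {w : Fin 2 → ℝ} (hw : w ≠ 0) : (parabolic w).1.IsParabolic := by
  refine ⟨?_, ?_⟩
  · rintro ⟨c, hc⟩
    have h0 : w 0 = 0 := by simpa [parabolic] using (congrFun₂ hc 1 0).symm
    have h1 : w 1 = 0 := by simpa [parabolic] using (congrFun₂ hc 0 1).symm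
    exact hw (funext (Fin.forall_fin_two.2 ⟨h0, h1⟩))
  · rw [Matrix.discr_fin_two, Matrix.trace_fin_two, (parabolic w).2]
    simp only [parabolic, Matrix.of_apply, Matrix.cons_val', Matrix.cons_val_zero,
      Matrix.cons_val_one, Matrix.cons_val_fin_one]
    ring

lemma isCusp_boundaryPoint (hg : IsCuspSystem Γ g) (κ : Fin K) :
    IsCusp (boundaryPoint (g κ)) (Γ.map Matrix.SpecialLinearGroup.toGL) := by
  have hstab := (hg.width_one κ _).2 ⟨1, Or.inl rfl⟩
  refine ⟨_, ⟨_, hstab.1, rfl⟩, ?_, hstab.2⟩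
  rw [Int.cast_one, conj_upperUni_one]
  exact isParabolic_parabolic fun hrow => zero_ne_one
    ((Matrix.det_eq_zero_of_row_eq_zero 1 (congrFun hrow)).symm.trans (g κ).2)

lemma eq_of_smul_boundaryPoint (hg : IsCuspSystem Γ g) {γ : SL(2, ℝ)} (hγ : γ ∈ Γ) {κ κ' : Fin K}
    (h : Matrix.SpecialLinearGroup.toGL γ • boundaryPoint (g κ) = boundaryPoint (g κ')) : κ = κ' :=
  (hg.complete _ (isCusp_boundaryPoint hg κ)).unique ⟨1, Γ.one_mem, by simp⟩ ⟨γ, hγ, h⟩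

lemma eq_of_upperUni_mul_diagExp_eq {s t s' t' : ℝ}
    (h : upperUni s * diagExp t = upperUni s' * diagExp t') : s = s' := by
  have hcoord : horoCoord (s, t, 0) = horoCoord (s', t', 0) := by
    simp only [horoCoord, h]
  exact congrArg Prod.fst (horoCoord_injective hcoord)

lemma eq_one_of_mul_sectionPoint_eq (hg : IsCuspSystem Γ g) {γ : SL(2, ℝ)} (hγ : γ ∈ Γ)
    {s t s' t' : ℝ} {κ κ' : Fin K} (hs : s ∈ Ico (0 : ℝ) 1) (hs' : s' ∈ Ico (0 : ℝ) 1)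
    (h : γ * sectionPoint g s t κ = sectionPoint g s' t' κ') : γ = 1 ∧ κ = κ' := by
  have hconj : g κ' * γ * (g κ)⁻¹ * (upperUni s * diagExp t) = upperUni s' * diagExp t' := by
    simp only [sectionPoint] at h
    rw [mul_assoc (g κ'), mul_assoc (g κ'), mul_assoc γ, ← mul_assoc (g κ)⁻¹, h]
    group
  have hfix : Matrix.SpecialLinearGroup.toGL γ • boundaryPoint (g κ) = boundaryPoint (g κ') := by
    rw [smul_boundaryPoint_eq_iff]
    have h10 := congrArg (· 1 0) hconj
    simpa [mul_apply_two, (Real.exp_pos _).ne'] using h10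
  obtain rfl := eq_of_smul_boundaryPoint hg hγ hfix
  refine ⟨?_, rfl⟩
  obtain ⟨m, rfl | rfl⟩ := (hg.width_one κ γ).1 ⟨hγ, hfix⟩
  · have hshift : upperUni (m + s) * diagExp t = upperUni s' * diagExp t' := by
      rw [← hconj, upperUni_add]
      group
    have hm := eq_of_upperUni_mul_diagExp_eq hshift
    have hm0 : m = 0 := by
      have hlt : (m : ℝ) < 1 := by linarith [hs.1, hs'.2]
      have hgt : (-1 : ℝ) < m := by linarith [hs.2, hs'.1]
      norm_cast at hlt hgt
      omega
    rw [hm0, Int.cast_zero, upperUni_zero, mul_one, inv_mul_cancel]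
  · exfalso
    have hneg : -(upperUni m * (upperUni s * diagExp t)) = upperUni s' * diagExp t' := by
      rw [← hconj]
      simp only [mul_neg, neg_mul]
      group
    have h11 : -Real.exp (-t / 2) = Real.exp (-t' / 2) := by
      simpa [mul_apply_two] using congrArg (· 1 1) hneg
    linarith [Real.exp_pos (-t / 2), Real.exp_pos (-t' / 2)]

lemma exists_isGreatest_inter_Iic {T : Set ℝ} (hT : ∀ R, (T ∩ Icc (-R) R).Finite)
    (hne : (T ∩ Iic 0).Nonempty) : ∃ x, IsGreatest (T ∩ Iic 0) x := by
  obtain ⟨y, hy, hy0⟩ := hne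
  have hfin : (T ∩ Icc y 0).Finite :=
    (hT (-y)).subset (inter_subset_inter_right _
      (Icc_subset_Icc (neg_neg y).le (neg_nonneg.2 hy0)))
  obtain ⟨x, ⟨hx, hyx, hx0⟩, hmax⟩ := exists_max_image _ id hfin ⟨y, hy, le_rfl, hy0⟩
  refine ⟨x, ⟨hx, hx0⟩, fun z ⟨hz, hz0⟩ => ?_⟩
  rcases le_total y z with hyz | hzy
  · exact hmax z ⟨hz, hyz, hz0⟩
  · exact hzy.trans hyx

lemma exists_mul_sectionPoint_eq_fract (hg : IsCuspSystem Γ g) (s t : ℝ) (κ : Fin K) :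
    ∃ γ ∈ Γ, γ * sectionPoint g s t κ = sectionPoint g (Int.fract s) t κ := by
  refine ⟨(g κ)⁻¹ * upperUni (-⌊s⌋ : ℤ) * g κ, ((hg.width_one κ _).2 ⟨_, Or.inl rfl⟩).1, ?_⟩
  have hfract : Int.fract s = (-⌊s⌋ : ℤ) + s := by
    rw [Int.cast_neg, neg_add_eq_sub, Int.self_sub_floor]
  rw [hfract, sectionPoint, sectionPoint, upperUni_add]
  group

lemma exists_mul_mem_flowBox [DiscreteTopology Γ] (hg : IsCuspSystem Γ g) {h : SL(2, ℝ)}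
    (hpast : (hitTimes Γ g σ h ∩ Iic 0).Nonempty) : ∃ γ ∈ Γ, ∃ κ, γ * h ∈ flowBox Γ g σ κ := by
  obtain ⟨x, hx⟩ := exists_isGreatest_inter_Iic (finite_hitTimes_inter hg h) hpast
  have hzero : 0 ∈ hitTimes Γ g σ (h * lowerUni (-x)) := by
    rw [mem_hitTimes_mul_lowerUni, add_zero]
    exact hx.1.1
  obtain ⟨κ, γ, hγ, s, t, ht, hpoint⟩ := zero_mem_hitTimes_iff.1 hzero
  obtain ⟨γ', hγ', hfract⟩ := exists_mul_sectionPoint_eq_fract hg s t κ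
  have hmem : γ' * γ ∈ Γ := Γ.mul_mem hγ' hγ
  have heq : sectionPoint g (Int.fract s) t κ * lowerUni (-(-x)) = γ' * γ * h := by
    rw [← hfract, ← hpoint, mul_assoc, mul_assoc, mul_assoc, ← lowerUni_add, neg_neg,
      neg_add_cancel, lowerUni_zero, mul_one, mul_assoc]
  refine ⟨_, hmem, κ, mem_flowBox.2 ⟨_, ⟨Int.fract_nonneg s, Int.fract_lt_one s⟩, t, ht, -x,
    neg_nonneg.2 hx.1.2, ?_, heq⟩⟩
  rwa [← isGreatest_hitTimes_iff hg ht (neg_nonneg.2 hx.1.2), heq, hitTimes_mul_left hmem, neg_neg]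

lemma eq_one_of_mul_mem_flowBox [DiscreteTopology Γ] (hg : IsCuspSystem Γ g) {γ h : SL(2, ℝ)}
    (hγ : γ ∈ Γ) {κ κ' : Fin K} (hmem : h ∈ flowBox Γ g σ κ) (hmem' : γ * h ∈ flowBox Γ g σ κ') :
    γ = 1 ∧ κ = κ' := by
  obtain ⟨s, hs, t, ht, r, hr, hlt, heq⟩ := mem_flowBox.1 hmem
  obtain ⟨s', hs', t', ht', r', hr', hlt', heq'⟩ := mem_flowBox.1 hmem'
  rw [← isGreatest_hitTimes_iff hg ht hr, heq] at hlt
  rw [← isGreatest_hitTimes_iff hg ht' hr', heq', hitTimes_mul_left hγ] at hlt'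
  rw [← hlt.unique hlt', ← heq, ← mul_assoc, mul_left_inj] at heq'
  exact eq_one_of_mul_sectionPoint_eq hg hγ hs hs' heq'.symm

lemma isFundamentalDomain_iUnion_flowBox [DiscreteTopology Γ] (hneg : (-1 : SL(2, ℝ)) ∈ Γ)
    (hg : IsCuspSystem Γ g) (hK : 0 < K) {D : Set SL(2, ℝ)} (hD : IsFundamentalDomain Γ D haarSL)
    (hfin : haarSL D ≠ ⊤) : IsFundamentalDomain Γ (⋃ κ, flowBox Γ g σ κ) haarSL := by
  have := countable_of_discreteTopology (Γ := Γ)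
  refine IsFundamentalDomain.mk'' ?_ ?_ ?_ fun γ =>
    (measurePreserving_smul γ haarSL).quasiMeasurePreserving
  · exact (MeasurableSet.iUnion (measurableSet_flowBox hg)).nullMeasurableSet
  · filter_upwards [ae_nonempty_hitTimes_inter_Iic hneg hK hD hfin] with h hpast
    obtain ⟨γ, hγ, κ, hmem⟩ := exists_mul_mem_flowBox hg hpast
    exact ⟨⟨γ, hγ⟩, mem_iUnion.2 ⟨κ, hmem⟩⟩
  · intro γ hγ
    refine Disjoint.aedisjoint (disjoint_left.2 ?_)
    rintro _ ⟨h, hh, rfl⟩ hh'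
    obtain ⟨κ, hmem⟩ := mem_iUnion.1 hh
    obtain ⟨κ', hmem'⟩ := mem_iUnion.1 hh'
    exact hγ (Subtype.ext (eq_one_of_mul_mem_flowBox hg γ.2 hmem hmem').1)

lemma haarSL_image_horoCoord (C : Set (ℝ × ℝ × ℝ)) : haarSL (horoCoord '' C) = horoMeasure C := by
  have hpos : horoCoord '' C ⊆ {h | 0 < h 1 1} := by
    rintro _ ⟨⟨x, t, r⟩, -, rfl⟩
    simp [horoCoord_coe, Real.exp_pos]
  rw [← inter_eq_self_of_subset_left hpos, ← Measure.restrict_apply' measurableSet_lowerRight_pos,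
    ← map_horoCoord, measurableEmbedding_horoCoord.map_apply,
    horoCoord_injective.preimage_image]

lemma volume_setOf_ofReal_lt (η : ℝ≥0∞) :
    volume {r : ℝ | 0 ≤ r ∧ ENNReal.ofReal r < η} = η := by
  rcases eq_or_ne η ⊤ with rfl | hη
  · have hset : {r : ℝ | 0 ≤ r ∧ ENNReal.ofReal r < ⊤} = Ici 0 := by
      ext r
      simp
    rw [hset, Real.volume_Ici]
  · have hset : {r : ℝ | 0 ≤ r ∧ ENNReal.ofReal r < η} = Ico 0 η.toReal := by
      ext r
      exact and_congr_right fun hr => ENNReal.ofReal_lt_iff_lt_toReal hr hη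
    rw [hset, Real.volume_Ico, sub_zero, ENNReal.ofReal_toReal hη]

lemma horoMeasure_apply {C : Set (ℝ × ℝ × ℝ)} (hC : MeasurableSet C) :
    horoMeasure C =
      ∫⁻ x : ℝ, ∫⁻ t : ℝ, ENNReal.ofReal (Real.exp (-t)) * volume {r | (x, t, r) ∈ C} := by
  rw [← lintegral_indicator_one hC, lintegral_horoMeasure (measurable_one.indicator hC)]
  refine lintegral_congr fun x => lintegral_congr fun t => congrArg _ ?_
  exact lintegral_indicator_one (hC.preimage (by fun_prop : Measurable fun r : ℝ => (x, t, r)))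

lemma volume_flowCoords_fiber (s t : ℝ) (κ : Fin K) :
    volume {r | (s, t, r) ∈ flowCoords Γ g σ κ} =
      (Ico 0 1).indicator (fun s => (Ici (σ κ)).indicator (returnTime Γ g σ s · κ) t) s := by
  by_cases hs : s ∈ Ico (0 : ℝ) 1
  · by_cases ht : t ∈ Ici (σ κ)
    · simp only [flowCoords, mem_ofPred_eq, hs, mem_Ici.1 ht, true_and, volume_setOf_ofReal_lt,
        indicator_of_mem hs, indicator_of_mem ht]
    · simp [flowCoords, ht, mem_Ici.not.1 ht]
  · simp [flowCoords, hs, -mem_Ico]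

lemma haarSL_flowBox [DiscreteTopology Γ] (hg : IsCuspSystem Γ g) (κ : Fin K) :
    haarSL (flowBox Γ g σ κ) = ∫⁻ s in Ico (0 : ℝ) 1, ∫⁻ t in Ici (σ κ),
      returnTime Γ g σ s t κ * ENNReal.ofReal (Real.exp (-t)) := by
  rw [flowBox, ← image_image (fun h => (g κ)⁻¹ * h), image_mul_left, inv_inv,
    measure_preimage_mul, haarSL_image_horoCoord, horoMeasure_apply (measurableSet_flowCoords hg κ),
    ← lintegral_indicator measurableSet_Ico]
  refine lintegral_congr fun s => ?_
  simp only [volume_flowCoords_fiber]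
  by_cases hs : s ∈ Ico (0 : ℝ) 1
  · simp only [indicator_of_mem hs]
    rw [← lintegral_indicator measurableSet_Ici]
    refine lintegral_congr fun t => ?_
    by_cases ht : t ∈ Ici (σ κ)
    · simp only [indicator_of_mem ht, mul_comm]
    · simp only [indicator_of_notMem ht, mul_zero]
  · simp only [indicator_of_notMem hs, mul_zero, lintegral_zero]

lemma sectionIntegral_returnTime [DiscreteTopology Γ] (hneg : (-1 : SL(2, ℝ)) ∈ Γ)
    (hg : IsCuspSystem Γ g) (hK : 0 < K) {F : Set ℍ} (hF : IsFundDomain Γ F)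
    (hvol : volume F < ⊤) :
    sectionIntegral σ (returnTime Γ g σ) = ENNReal.ofReal Real.pi * volume F := by
  have := countable_of_discreteTopology (Γ := Γ)
  have hD := isFundamentalDomain_halfLift hneg hF
  have hvolD : haarSL (halfLift F) = ENNReal.ofReal Real.pi * volume F :=
    haarSL_halfLift hF.nullMeasurableSet
  have hfin : haarSL (halfLift F) ≠ ⊤ :=
    hvolD.trans_ne (ENNReal.mul_ne_top ENNReal.ofReal_ne_top hvol.ne)
  have hdisj : Pairwise fun κ κ' => Disjoint (flowBox Γ g σ κ) (flowBox Γ g σ κ') :=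
    fun κ κ' hne => disjoint_left.2 fun h hmem hmem' =>
      hne (eq_one_of_mul_mem_flowBox hg Γ.one_mem hmem (by rwa [one_mul])).2
  calc sectionIntegral σ (returnTime Γ g σ) = ∑ κ, haarSL (flowBox Γ g σ κ) := by
        simp only [sectionIntegral, haarSL_flowBox hg]
    _ = haarSL (⋃ κ, flowBox Γ g σ κ) := by
        rw [measure_iUnion hdisj (measurableSet_flowBox hg), tsum_fintype]
    _ = haarSL (halfLift F) :=
        (isFundamentalDomain_iUnion_flowBox hneg hg hK hD hfin).measure_eq hD
    _ = ENNReal.ofReal Real.pi * volume F := hvolD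

lemma sectionIntegral_one (σ : Fin K → ℝ) :
    sectionIntegral σ (fun _ _ _ => 1) = ENNReal.ofReal (∑ κ, Real.exp (-σ κ)) := by
  have htail (a : ℝ) : ∫⁻ t in Ici a, ENNReal.ofReal (Real.exp (-t)) =
      ENNReal.ofReal (Real.exp (-a)) := by
    rw [setLIntegral_congr Ioi_ae_eq_Ici.symm, ← ofReal_integral_eq_lintegral_ofReal
      (integrableOn_exp_neg_Ioi a) (.of_forall fun t => (Real.exp_pos _).le),
      integral_exp_neg_Ioi]
  rw [ENNReal.ofReal_sum_of_nonneg fun κ _ => (Real.exp_pos _).le, sectionIntegral]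
  simp [htail]

end CuspSection

end

theorem mainTheorem10 (Γ : Subgroup SL(2, ℝ)) [DiscreteTopology Γ] (hneg : (-1 : SL(2, ℝ)) ∈ Γ)
    (F : Set ℍ) (hF : CuspSection.IsFundDomain Γ F)
    (hvol : MeasureTheory.volume F < ⊤)
    (K : ℕ) (hK : 0 < K) (g : Fin K → SL(2, ℝ)) (hg : CuspSection.IsCuspSystem Γ g)
    (σ : Fin K → ℝ) :
    (∀ (r s t : ℝ) (κ : Fin K), 0 < r → s ∈ Set.Ico (0 : ℝ) 1 → σ κ ≤ t →
      CuspSection.density Γ g σ r s t κ =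
        1 / (CuspSection.meanReturnTime Γ g σ).toReal *
          ∏ ℓ : Fin K, CuspSection.emptyIndicator
            (CuspSection.scaledSet (Real.exp (σ ℓ / 2)) (CuspSection.cuspOrbit Γ g ℓ)
              ((g κ)⁻¹ * CuspSection.upperUni s * CuspSection.diagExp t) ∩
                CuspSection.negTriangle r)) ∧
    CuspSection.meanReturnTime Γ g σ =
      ENNReal.ofReal
        (Real.pi * (MeasureTheory.volume F).toReal * (∑ κ : Fin K, Real.exp (-σ κ))⁻¹) := by
  refine ⟨fun r s t κ hr _ _ => CuspSection.density_eq_prod hg hr.le s t κ, ?_⟩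
  have : Nonempty (Fin K) := ⟨⟨0, hK⟩⟩
  have hsum : 0 < ∑ κ : Fin K, Real.exp (-σ κ) :=
    Finset.sum_pos (fun κ _ => Real.exp_pos _) Finset.univ_nonempty
  rw [CuspSection.meanReturnTime, CuspSection.sectionIntegral_returnTime hneg hg hK hF hvol,
    CuspSection.sectionIntegral_one, ← div_eq_mul_inv, ENNReal.ofReal_div_of_pos hsum,
    ENNReal.ofReal_mul Real.pi_pos.le, ENNReal.ofReal_toReal hvol.ne]
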